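/- Let $X\subset\mathbb{A}^n$ be a smooth ($C^\infty$), possibly immersed, $r$-dimensional variety in real affine $n$-space, with tangent spaces $T_x(X)$. Let $X$ be normalized: to each $x\in X$ there is assigned, smoothly in $x$, an affine subspace $N_x$ (the first normal) of dimension $l=n-r$ with $T_x(X)\cap N_x=\{x\}$; the second normal is $K_x=T_x(X)\cap\mathbb{P}_\infty$, where $\mathbb{P}_\infty$ is the hyperplane at infinity. The normal connection $\gamma_n$ is the connection $\nabla_u s=\mathrm{pr}_{N}(ds(u))$ on smooth fields $s$ of vectors lying in the directions of the first normals, where $\mathrm{pr}_N$ is the projection onto the direction of $N_x$ along that of $T_x(X)$; it is flat if its curvature $R(u,v)s=\nabla_u\nabla_v s-\nabla_v\nabla_u s-\nabla_{[u,v]}s$ vanishes identically. For $y\in N_x$ let $\Delta_y=y\wedge K_x$, the affine subspace through $y$ parallel to $T_x(X)$. A variety parallel to $X$ over an open set $U\subset X$ is given by a smooth map $g$ on $U$ with $g(x)\in N_x$ that is an integral manifold of the distribution $\Delta$, that is, the image of $dg_x$ is contained in the direction of $\Delta_{g(x)}$ for all $x\in U$, and is equal to it (so that the tangent space of the parallel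 variety at $g(x)$ is $\Delta_{g(x)}$, hence parallel to $T_x(X)$) whenever $g(x)$ is not a focus of $N_x$. Here $y\in N_x$ is a focus if some smooth local field $s$ of points $s(x')\in N_{x'}$ with $s(x)=y$ has $ds_x(w)$ in the direction of $N_x$ for some tangent vector $w\neq0$. An $l$-parameter family of parallel varieties over $U$, with parameter $y\in N_{x_0}$, $x_0\in U$, is a family of parallel varieties $X(y)$ over $U$, given by maps $g_y$ with $g_y(x_0)=y$, such that $g_y(x)$ depends smoothly on $(x,y)$ and, for every $x\in U$, the map $y\mapsto g_y(x)$ is a bijection from $N_{x_0}$ onto $N_x$. **Theorem.** The normal connection $\gamma_n$ of $X$ is flat if and only if every point $x_0\in X$ has an open neighbourhood $U$ in $X$ over which there is an $l$-parameter family of parallel varieties $X(y)$, $y\in N_{x_0}$. If $X$ is simply connected, then $\gamma_n$ is flat if and only if for every $x_0\in X$ there is such a family over the whole of $X$. -/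

import Mathlib

open scoped Manifold ContDiff

/-- A normalized variety `X` of dimension `r` and codimension `l` in the affine space `E`
(a finite-dimensional real vector space regarded as an affine space over itself; `dim E = r + l`).
The variety is given by a smooth immersion `pos` of an `r`-dimensional smooth manifold `M`.
In an affine space the second normal of `X` is the intersection of the tangent space
with the hyperplane at infinity, so a normalization amounts to the smooth field of first normals:
`normal x` is the direction of the first normal at `x`, an `l`-dimensional
complement of the direction of the tangent space. -/
structure NormalizedVariety (r l : ℕ)
    (M : Type*) [TopologicalSpace M] [ChartedSpace (EuclideanSpace ℝ (Fin r)) M]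
    [IsManifold (𝓡 r) ∞ M]
    (E : Type*) [NormedAddCommGroup E] [NormedSpace ℝ E] where
  /-- the position of the point `x` of the variety in the affine space -/
  pos : M → E
  contMDiff_pos : ContMDiff (𝓡 r) 𝓘(ℝ, E) ∞ pos
  injective_mfderiv_pos : ∀ x : M, Function.Injective (mfderiv (𝓡 r) 𝓘(ℝ, E) pos x)
  /-- the direction of the first normal at `x` -/
  normal : M → Submodule ℝ E
  isCompl_tangent_normal : ∀ x : M,
    IsCompl (LinearMap.range (mfderiv (𝓡 r) 𝓘(ℝ, E) pos x).toLinearMap : Submodule ℝ E) (normal x)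
  /-- the first normals depend smoothly on the point: they have smooth local frames -/
  exists_smooth_frame : ∀ x₀ : M, ∃ U : Set M, IsOpen U ∧ x₀ ∈ U ∧
    ∃ A : Fin l → M → E,
      (∀ a, ContMDiffOn (𝓡 r) 𝓘(ℝ, E) ∞ (A a) U) ∧
      ∀ x ∈ U, LinearIndependent ℝ (fun a => A a x) ∧
        Submodule.span ℝ (Set.range fun a => A a x) = normal x

namespace NormalizedVariety

variable {r l : ℕ}
  {M : Type*} [TopologicalSpace M] [ChartedSpace (EuclideanSpace ℝ (Fin r)) M]
  [IsManifold (𝓡 r) ∞ M]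
  {E : Type*} [NormedAddCommGroup E] [NormedSpace ℝ E]
  (X : NormalizedVariety r l M E)

/-- The image of the differential at `x` of a map `g : M → E`: the direction of the tangent
space of the variety described by `g`. -/
noncomputable def imageDirection (r : ℕ) {M : Type*} [TopologicalSpace M]
    [ChartedSpace (EuclideanSpace ℝ (Fin r)) M] {E : Type*} [NormedAddCommGroup E] [NormedSpace ℝ E]
    (g : M → E) (x : M) : Submodule ℝ E :=
  LinearMap.range (mfderiv (𝓡 r) 𝓘(ℝ, E) g x).toLinearMap

/-- The direction of the tangent space `T_x(X)`. -/
noncomputable def tangentDirection (x : M) : Submodule ℝ E :=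
  imageDirection r X.pos x

/-- The first normal `N_x`, an affine subspace of dimension `l` through the point `x` of `X`. -/
def firstNormal (x : M) : AffineSubspace ℝ E :=
  AffineSubspace.mk' (X.pos x) (X.normal x)

/-- The element `Δ_y = y ∧ K_x` of the distribution, for a point `y ∈ N_x`: the span of `y` and of
the points at infinity of `T_x(X)`, i.e. the affine subspace through `y` parallel to `T_x(X)`. -/
noncomputable def Delta (x : M) (y : E) : AffineSubspace ℝ E :=
  AffineSubspace.mk' y (X.tangentDirection x)

/-- The projection of `E` onto the direction of the first normal along the tangent directions. -/
noncomputable def normalProj (x : M) : E →ₗ[ℝ] E :=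
  (X.normal x).projection _ (X.isCompl_tangent_normal x).symm

/-- The normal connection `γ_n`: the covariant derivative, along the vector field `u`, of a field
`s` of vectors lying in the first normals, is the normal component of the derivative of `s`. -/
noncomputable def normalCovDeriv (u : Π x : M, TangentSpace (𝓡 r) x) (s : M → E) (x : M) : E :=
  X.normalProj x (mfderiv (𝓡 r) 𝓘(ℝ, E) s x (u x))

/-- The curvature `R(u, v) s = ∇_u ∇_v s - ∇_v ∇_u s - ∇_[u, v] s` of the normal connection. -/
noncomputable def normalCurvature (u v : Π x : M, TangentSpace (𝓡 r) x) (s : M → E) (x : M) : E :=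
  X.normalCovDeriv u (X.normalCovDeriv v s) x - X.normalCovDeriv v (X.normalCovDeriv u s) x
    - X.normalCovDeriv (VectorField.mlieBracket (𝓡 r) u v) s x

/-- `s` is a smooth field, over the open set `W`, of vectors lying in the first normals. -/
def IsNormalField (s : M → E) (W : Set M) : Prop :=
  ContMDiffOn (𝓡 r) 𝓘(ℝ, E) ∞ s W ∧ ∀ x ∈ W, s x ∈ X.normal x

/-- The normal connection is flat: its curvature vanishes, on all smooth local vector fields
`u`, `v` and all smooth local fields `s` of normal vectors. -/
def IsFlatNormalConnection : Prop :=
  ∀ W : Set M, IsOpen W → ∀ u v : Π x : M, TangentSpace (𝓡 r) x,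
    ContMDiffOn (𝓡 r) (𝓡 r).tangent ∞ (fun x => (⟨x, u x⟩ : TangentBundle (𝓡 r) M)) W →
    ContMDiffOn (𝓡 r) (𝓡 r).tangent ∞ (fun x => (⟨x, v x⟩ : TangentBundle (𝓡 r) M)) W →
    ∀ s : M → E, X.IsNormalField s W → ∀ x ∈ W, X.normalCurvature u v s x = 0

/-- The point `y` is a focus of the first normal `N_x`: for some smooth local field `s` of points
of the first normals with `s x = y`, and some displacement `w ≠ 0` of the point `x`, the
differential `ds(w)` lies in the direction of `N_x`. -/
def IsFocus (x : M) (y : E) : Prop :=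
  ∃ W : Set M, IsOpen W ∧ x ∈ W ∧ ∃ s : M → E,
    ContMDiffOn (𝓡 r) 𝓘(ℝ, E) ∞ s W ∧ (∀ x' ∈ W, s x' ∈ X.firstNormal x') ∧ s x = y ∧
    ∃ w : TangentSpace (𝓡 r) x, w ≠ 0 ∧ (mfderiv (𝓡 r) 𝓘(ℝ, E) s x w : E) ∈ X.normal x

/-- `g` describes a variety parallel to the part of `X` over the open set `U`:
it assigns to every point `x ∈ U` smoothly a point `g x ∈ N_x` and is an integral manifold of the
distribution `y ↦ Δ_y`. Its tangent space at `g x` is then the whole of `Δ_(g x)`, hence parallel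
to `T_x(X)`, unless `g x` is a focus of `N_x`, where the map `g` may fail to be an immersion. -/
structure IsParallelVariety (U : Set M) (g : M → E) : Prop where
  contMDiffOn : ContMDiffOn (𝓡 r) 𝓘(ℝ, E) ∞ g U
  mem_firstNormal : ∀ x ∈ U, g x ∈ X.firstNormal x
  tangent_le : ∀ x ∈ U, AffineSubspace.mk' (g x) (imageDirection r g x) ≤ X.Delta x (g x)
  tangent_eq : ∀ x ∈ U, ¬ X.IsFocus x (g x) →
    AffineSubspace.mk' (g x) (imageDirection r g x) = X.Delta x (g x)

/-- `Y` is an `l`-parameter family, over the open set `U`, of varieties parallel to `X`.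
The parameter is the point `y = x₀ + η` of the first normal `N_(x₀)`, through
which the variety `Y η` passes. The family is smooth, and exactly one of its members passes through
each point of each first normal `N_x` at the parameter point `x`, `x ∈ U`. -/
structure IsParallelFamily (U : Set M) (x₀ : M) (Y : X.normal x₀ → M → E) : Prop where
  contMDiffOn : ContMDiffOn ((𝓡 r).prod 𝓘(ℝ, X.normal x₀)) 𝓘(ℝ, E) ∞
    (fun p : M × X.normal x₀ => Y p.2 p.1) (U ×ˢ Set.univ)
  isParallelVariety : ∀ η, X.IsParallelVariety U (Y η)
  apply_base : ∀ η, Y η x₀ = X.pos x₀ + η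
  bijOn : ∀ x ∈ U, Set.BijOn (fun η => Y η x) Set.univ (X.firstNormal x : Set E)

/-- Every point of `X` has a neighbourhood in `X` that admits an `l`-parameter family of parallel
varieties. -/
def AdmitsParallelFamilyLocally : Prop :=
  ∀ x₀ : M, ∃ U : Set M, IsOpen U ∧ x₀ ∈ U ∧ ∃ Y : X.normal x₀ → M → E, X.IsParallelFamily U x₀ Y

/-- The whole of `X` admits an `l`-parameter family of parallel varieties. -/
def AdmitsParallelFamilyGlobally : Prop :=
  ∀ x₀ : M, ∃ Y : X.normal x₀ → M → E, X.IsParallelFamily Set.univ x₀ Y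

end NormalizedVariety

/-!
Write `π x` for the projection of `E` onto the direction of the first normal at `x` along the
tangent directions; it depends smoothly on `x` (`contMDiff_normalProjL`), and `dπ` interchanges the
tangent and the normal directions. Differentiating `s = π s` shows that a field `s` of normal vectors
is parallel, `π ds = 0`, exactly when it solves the linear total differential equation `ds = dπ s`,
and that the curvature is
`R(u, v) s = π (dπ(u) dπ(v) s - dπ(v) dπ(u) s)` (`normalCurvature_eq`).
On the other hand `g = pos + s` describes a parallel variety exactly when `s` is a parallel field of
normal vectors: `dg` lies in the tangent directions if and only if `ds` does. Away from the foci `dg`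
is injective, so that its image is the whole tangent direction. Thus families of parallel varieties
are the same as parallel frames of the normals (`IsParallelFrame.isParallelFamily`).

If parallel varieties pass through all points of the first normals, then every normal vector at a
point extends to a parallel field, on which the curvature vanishes; as the curvature at the point
depends only on the value of the field there, the connection is flat.

If the connection is flat, the values of `dπ` commute on the normals, which is the integrability
condition of `dS = dπ ∘ S` (`exists_parallel_operator_field`). The equation is solved along the radii
of a small ball in a chart. The derivative of the resulting operator field is found by comparing the
radial solutions `σ` in the directions `x` and `x + h`: by integrability, `σ + t dπ(h) σ` solves the
equation in the direction `x + h` up to an error quadratic in `h`, and Grönwall's inequality applies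
(`hasFDerivAt_radial_solution`). Smoothness follows by bootstrapping.

If, in addition, the variety is simply connected, the local parallel frames differ by locally constant
changes of basis, since a parallel field that vanishes at a point vanishes nearby. These form a
locally constant cocycle, which is a coboundary because the covering that it defines has a section
(`exists_coboundary_of_locally_constant_cocycle`), and the corrected frames fit together globally.
-/

set_option maxSynthPendingDepth 3

/-! ### Linear total differential equations -/

section LinearTotalEquation

open Set Metric Filter Topology

variable {V : Type*} [NormedAddCommGroup V] [NormedSpace ℝ V]
  {F : Type*} [NormedAddCommGroup F] [NormedSpace ℝ F]

lemma add_smul_mem_ball {a x : V} {ρ t : ℝ} (hx : a + x ∈ ball a ρ) (ht : t ∈ Icc (0 : ℝ) 1) :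
    a + t • x ∈ ball a ρ := by
  rw [mem_ball, dist_eq_norm, add_sub_cancel_left] at *
  rw [norm_smul, Real.norm_eq_abs, abs_of_nonneg ht.1]
  nlinarith [norm_nonneg x, ht.1, ht.2]

/-- Solutions of the linear total differential equation `dS = A S` along the radii of a small ball,
with the value `e` at the centre. -/
lemma exists_radial_solution [CompleteSpace F] {A : V → V →L[ℝ] F →L[ℝ] F} {a : V} {ρ K : ℝ}
    (hA : ContinuousOn A (ball a ρ)) (hK : ∀ y ∈ ball a ρ, ‖A y‖ ≤ K) (hKρ : K * ρ ≤ 1 / 2) (e : F)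
    {x : V} (hx : a + x ∈ ball a ρ) :
    ∃ σ : ℝ → F, σ 0 = e ∧ ∀ t ∈ Icc (0 : ℝ) 1,
      HasDerivWithinAt σ (A (a + t • x) x (σ t)) (Icc 0 1) t := by
  have hxρ : ‖x‖ ≤ ρ := by
    rw [mem_ball, dist_eq_norm, add_sub_cancel_left] at hx; exact hx.le
  have hK0 : 0 ≤ K := (norm_nonneg _).trans (hK _ hx)
  have hop : ∀ t ∈ Icc (0 : ℝ) 1, ‖A (a + t • x) x‖ ≤ 1 / 2 := fun t ht =>
    calc ‖A (a + t • x) x‖ ≤ ‖A (a + t • x)‖ * ‖x‖ := (A (a + t • x)).le_opNorm x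
      _ ≤ K * ρ := by gcongr; exact hK _ (add_smul_mem_ball hx ht)
      _ ≤ 1 / 2 := hKρ
  have hPL : IsPicardLindelof (fun t T => A (a + t • x) x T)
      (⟨0, by simp⟩ : Icc (0 : ℝ) 1) e (‖e‖₊ + 1) 0 (‖e‖₊ + 1) 1 := by
    refine ⟨fun t ht => ?_, fun T _ => ?_, fun t ht T hT => ?_, ?_⟩
    · refine LipschitzOnWith.of_dist_le_mul fun T _ T' _ => ?_
      rw [dist_eq_norm, dist_eq_norm, ← map_sub]
      refine (ContinuousLinearMap.le_opNorm _ _).trans ?_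
      have := hop t ht
      gcongr
      rw [NNReal.coe_one]; linarith
    · have h1 : ContinuousOn (fun t : ℝ => A (a + t • x)) (Icc 0 1) :=
        hA.comp (by fun_prop) fun t ht => add_smul_mem_ball hx ht
      exact (h1.clm_apply continuousOn_const).clm_apply continuousOn_const
    · refine (ContinuousLinearMap.le_opNorm _ _).trans ?_
      have h1 := hop t ht
      have h2 : ‖T‖ ≤ ‖e‖ + (‖e‖ + 1) := by
        have := norm_le_norm_add_norm_sub' T e
        rw [mem_closedBall, dist_eq_norm] at hT
        push_cast at hT
        linarith
      push_cast
      nlinarith [norm_nonneg T, norm_nonneg e, norm_nonneg (A (a + t • x) x)]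
    · simp
  obtain ⟨σ, h0, h⟩ := hPL.exists_eq_forall_mem_Icc_hasDerivWithinAt₀
  exact ⟨σ, h0, h⟩

/-- The solution of a linear total differential equation on a ball is determined by its value at
the centre. -/
lemma eq_zero_of_hasFDerivAt_linear {A : V → V →L[ℝ] F →L[ℝ] F} {a : V} {ρ K : ℝ}
    (hK : ∀ y ∈ ball a ρ, ‖A y‖ ≤ K) {s : V → F}
    (hs : ∀ y ∈ ball a ρ, HasFDerivAt s ((A y).flip (s y)) y) (h0 : s a = 0) :
    ∀ y ∈ ball a ρ, s y = 0 := by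
  intro y hy
  obtain ⟨x, rfl⟩ : ∃ x, y = a + x := ⟨y - a, by abel⟩
  have hd : ∀ t ∈ Icc (0 : ℝ) 1,
      HasDerivAt (fun t : ℝ => s (a + t • x)) (A (a + t • x) x (s (a + t • x))) t := by
    intro t ht
    have h1 : HasDerivAt (fun t : ℝ => a + t • x) x t := by
      simpa using ((hasDerivAt_id t).smul_const x).const_add a
    exact (hs _ (add_smul_mem_ball hy ht)).comp_hasDerivAt t h1
  have := eq_zero_of_abs_deriv_le_mul_abs_self_of_eq_zero_right (K := K * ‖x‖)
    (f := fun t : ℝ => s (a + t • x)) (a := 0) (b := 1)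
    (fun t ht => (hd t ht).continuousAt.continuousWithinAt)
    (fun t ht => (hd t ⟨ht.1, ht.2.le⟩).hasDerivWithinAt) (by simpa using h0)
    (fun t ht => by
      refine (ContinuousLinearMap.le_opNorm _ _).trans ?_
      gcongr
      refine (ContinuousLinearMap.le_opNorm _ _).trans ?_
      gcongr
      exact hK _ (add_smul_mem_ball hy ⟨ht.1, ht.2.le⟩)) 1 (by simp)
  simpa using this

/-- The second-order Taylor bound for a map whose derivative is Lipschitz. -/
lemma norm_sub_sub_le_of_lipschitz_fderiv {G : Type*} [NormedAddCommGroup G] [NormedSpace ℝ G]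
    {A : V → G} {D : V → V →L[ℝ] G} {s : Set V} (hs : Convex ℝ s) {K : ℝ}
    (hD : ∀ y ∈ s, HasFDerivAt A (D y) y) (hL : ∀ y ∈ s, ∀ z ∈ s, ‖D y - D z‖ ≤ K * ‖y - z‖)
    (hK : 0 ≤ K) {y z : V} (hy : y ∈ s) (hz : z ∈ s) :
    ‖A z - A y - D y (z - y)‖ ≤ K * ‖z - y‖ ^ 2 := by
  have hseg : segment ℝ y z ⊆ s := hs.segment_subset hy hz
  have := (convex_segment y z).norm_image_sub_le_of_norm_hasFDerivWithin_le' (𝕜 := ℝ)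
    (f := A) (f' := D) (φ := D y) (C := K * ‖z - y‖)
    (fun w hw => (hD w (hseg hw)).hasFDerivWithinAt)
    (fun w hw => (hL w (hseg hw) y hy).trans (by
      gcongr
      exact norm_sub_le_of_mem_segment hw))
    (left_mem_segment ℝ y z) (right_mem_segment ℝ y z)
  rwa [pow_two, ← mul_assoc]

/-- The estimate behind the differentiability of the radial solutions of `dS = A S`: if the
equation is integrable along the radial solution `f`, then `f + t A(h) f` solves the radial equation
in the direction `x + h` up to an error that is quadratic in `h`. -/
lemma norm_approx_radial_le {x h : V} {t K m : ℝ} (ht : t ∈ Icc (0 : ℝ) 1)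
    {Ay Az : V →L[ℝ] F →L[ℝ] F} {D : V →L[ℝ] V →L[ℝ] F →L[ℝ] F} {f : F}
    (hAy : ‖Ay‖ ≤ K) (hD : ‖D‖ ≤ K) (hR : ‖Az - Ay - D (t • h)‖ ≤ K * ‖t • h‖ ^ 2)
    (hxh : ‖x + h‖ ≤ 1) (hh : ‖h‖ ≤ 2) (hf : ‖f‖ ≤ m)
    (hflat : D x h f + Ay h (Ay x f) = D h x f + Ay x (Ay h f)) :
    ‖(Ay x f + (Ay h f + t • (D x h f + Ay h (Ay x f)))) - Az (x + h) (f + t • Ay h f)‖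
      ≤ (4 * K ^ 2 + 2 * K) * m * ‖h‖ ^ 2 := by
  have hK0 : 0 ≤ K := (norm_nonneg _).trans hAy
  have hm0 : 0 ≤ m := (norm_nonneg _).trans hf
  set R := Az - Ay - D (t • h) with hRdef
  have hAz : Az = Ay + t • D h + R := by rw [hRdef, map_smul]; abel
  have key : (Ay x f + (Ay h f + t • (D x h f + Ay h (Ay x f)))) - Az (x + h) (f + t • Ay h f)
      = -(t • Ay h (Ay h f) + t • D h h f + (t * t) • D h (x + h) (Ay h f)
        + R (x + h) (f + t • Ay h f)) := by
    rw [hflat, hAz]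
    simp only [add_apply, smul_apply, map_add, map_smul,
      smul_add, smul_smul]
    abel
  have ht0 : ‖t‖ ≤ 1 := by rw [Real.norm_eq_abs, abs_of_nonneg ht.1]; exact ht.2
  have hAh : ∀ g : F, ‖Ay h g‖ ≤ K * ‖h‖ * ‖g‖ := fun g => Ay.le_of_opNorm₂_le_of_le hAy le_rfl le_rfl
  have hAhf : ‖Ay h f‖ ≤ K * ‖h‖ * m := (hAh f).trans (by gcongr)
  have hDh : ‖D h‖ ≤ K * ‖h‖ := D.le_of_opNorm_le hD h
  have hR' : ‖R‖ ≤ K * ‖h‖ ^ 2 := hR.trans (by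
    rw [norm_smul]
    gcongr
    exact mul_le_of_le_one_left (norm_nonneg _) ht0)
  have h1 : ‖t • Ay h (Ay h f)‖ ≤ K ^ 2 * m * ‖h‖ ^ 2 := by
    rw [norm_smul]
    calc ‖t‖ * ‖Ay h (Ay h f)‖ ≤ 1 * (K * ‖h‖ * (K * ‖h‖ * m)) := by
          gcongr; exact (hAh _).trans (by gcongr)
      _ = K ^ 2 * m * ‖h‖ ^ 2 := by ring
  have h2 : ‖t • D h h f‖ ≤ K * m * ‖h‖ ^ 2 := by
    rw [norm_smul]
    calc ‖t‖ * ‖D h h f‖ ≤ 1 * (K * ‖h‖ * ‖h‖ * m) := by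
          gcongr; exact (D h).le_of_opNorm₂_le_of_le hDh le_rfl hf
      _ = K * m * ‖h‖ ^ 2 := by ring
  have h3 : ‖(t * t) • D h (x + h) (Ay h f)‖ ≤ K ^ 2 * m * ‖h‖ ^ 2 := by
    rw [norm_smul, norm_mul]
    calc ‖t‖ * ‖t‖ * ‖D h (x + h) (Ay h f)‖ ≤ 1 * 1 * (K * ‖h‖ * 1 * (K * ‖h‖ * m)) := by
          gcongr; exact (D h).le_of_opNorm₂_le_of_le hDh hxh hAhf
      _ = K ^ 2 * m * ‖h‖ ^ 2 := by ring
  have h4 : ‖R (x + h) (f + t • Ay h f)‖ ≤ (K + 2 * K ^ 2) * m * ‖h‖ ^ 2 := by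
    have hQ : ‖f + t • Ay h f‖ ≤ m + 1 * (K * 2 * m) := by
      refine (norm_add_le _ _).trans ?_
      rw [norm_smul]
      gcongr
      exact hAhf.trans (by gcongr)
    calc _ ≤ K * ‖h‖ ^ 2 * 1 * (m + 1 * (K * 2 * m)) := R.le_of_opNorm₂_le_of_le hR' hxh hQ
      _ = _ := by ring
  rw [key, norm_neg]
  calc _ ≤ K ^ 2 * m * ‖h‖ ^ 2 + K * m * ‖h‖ ^ 2 + K ^ 2 * m * ‖h‖ ^ 2
        + (K + 2 * K ^ 2) * m * ‖h‖ ^ 2 := by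
        refine (norm_add_le _ _).trans (add_le_add ((norm_add_le _ _).trans (add_le_add
          ((norm_add_le _ _).trans (add_le_add h1 h2)) h3)) h4)
    _ = _ := by ring

/-- If the linear total differential equation `dS = A S` is integrable along its radial solutions
`σ x`, then the end points of the radial solutions form a genuine solution. -/
lemma hasFDerivAt_radial_solution {A : V → V →L[ℝ] F →L[ℝ] F}
    {D : V → V →L[ℝ] V →L[ℝ] F →L[ℝ] F} {a : V} {ρ K : ℝ} (hρ : ρ ≤ 1)
    (hD : ∀ y ∈ ball a ρ, HasFDerivAt A (D y) y) (hAK : ∀ y ∈ ball a ρ, ‖A y‖ ≤ K)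
    (hDK : ∀ y ∈ ball a ρ, ‖D y‖ ≤ K)
    (hDL : ∀ y ∈ ball a ρ, ∀ z ∈ ball a ρ, ‖D y - D z‖ ≤ K * ‖y - z‖) {e : F} {σ : V → ℝ → F}
    (hσ0 : ∀ x, a + x ∈ ball a ρ → σ x 0 = e)
    (hσ : ∀ x, a + x ∈ ball a ρ → ∀ t ∈ Icc (0 : ℝ) 1,
      HasDerivWithinAt (σ x) (A (a + t • x) x (σ x t)) (Icc 0 1) t)
    (hflat : ∀ x, a + x ∈ ball a ρ → ∀ t ∈ Icc (0 : ℝ) 1, ∀ h : V,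
      D (a + t • x) x h (σ x t) + A (a + t • x) h (A (a + t • x) x (σ x t)) =
      D (a + t • x) h x (σ x t) + A (a + t • x) x (A (a + t • x) h (σ x t)))
    {x : V} (hx : a + x ∈ ball a ρ) :
    HasFDerivAt (fun z => σ z 1) ((A (a + x)).flip (σ x 1)) x := by
  have hK0 : 0 ≤ K := (norm_nonneg _).trans (hAK _ hx)
  have hnorm : ∀ z, a + z ∈ ball a ρ ↔ ‖z‖ < ρ := fun z => by
    rw [mem_ball, dist_eq_norm, add_sub_cancel_left]
  obtain ⟨m, hm⟩ : ∃ m, ∀ t ∈ Icc (0 : ℝ) 1, ‖σ x t‖ ≤ m :=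
    isCompact_Icc.exists_bound_of_continuousOn fun t ht => (hσ x hx t ht).continuousWithinAt
  set C := (4 * K ^ 2 + 2 * K) * m with hC
  set κ := gronwallBound 0 (K + 1) C 1 with hκ
  have hK1 : K + 1 ≠ 0 := by positivity
  -- Grönwall's inequality for the difference of the approximate and the true radial solution.
  have main : ∀ h, a + (x + h) ∈ ball a ρ →
      ‖σ (x + h) 1 - σ x 1 - A (a + x) h (σ x 1)‖ ≤ κ * ‖h‖ ^ 2 := by
    intro h hxh
    have hh : ‖h‖ ≤ 2 := by
      have h1 := (hnorm _).1 hxh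
      have h2 := (hnorm _).1 hx
      have : h = (x + h) - x := by abel
      rw [this]
      refine (norm_sub_le _ _).trans ?_
      linarith
    have hxh1 : ‖x + h‖ ≤ 1 := ((hnorm _).1 hxh).le.trans hρ
    let w : ℝ → F := fun t => σ x t + t • A (a + t • x) h (σ x t) - σ (x + h) t
    let w' : ℝ → F := fun t => A (a + t • x) x (σ x t) + (A (a + t • x) h (σ x t)
      + t • (D (a + t • x) x h (σ x t) + A (a + t • x) h (A (a + t • x) x (σ x t))))
      - A (a + t • (x + h)) (x + h) (σ (x + h) t)
    have hw : ∀ t ∈ Icc (0 : ℝ) 1, HasDerivWithinAt w (w' t) (Icc 0 1) t := by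
      intro t ht
      have hl : HasDerivAt (fun t : ℝ => a + t • x) x t := by
        simpa using ((hasDerivAt_id t).smul_const x).const_add a
      have h1 : HasDerivAt (fun t : ℝ => A (a + t • x)) (D (a + t • x) x) t :=
        (hD _ (add_smul_mem_ball hx ht)).comp_hasDerivAt t hl
      have h2 : HasDerivAt (fun t : ℝ => A (a + t • x) h) (D (a + t • x) x h) t := by
        simpa using h1.clm_apply (hasDerivAt_const t h)
      have h3 := h2.hasDerivWithinAt (s := Icc 0 1) |>.clm_apply (hσ x hx t ht)
      have h4 := (hasDerivWithinAt_id t (Icc 0 1)).smul h3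
      have h5 := ((hσ x hx t ht).add h4).sub (hσ _ hxh t ht)
      refine h5.congr_deriv ?_
      simp only [w', id, one_smul]
      abel
    have hgr := norm_le_gronwallBound_of_norm_deriv_right_le (f := w) (f' := w') (δ := 0)
      (K := K + 1) (ε := C * ‖h‖ ^ 2) (a := 0) (b := 1)
      (fun t ht => (hw t ht).continuousWithinAt)
      (fun t ht => (hw t ⟨ht.1, ht.2.le⟩).mono_of_mem_nhdsWithin
        (Icc_mem_nhdsGE_of_mem ht))
      (by simp [w, hσ0 x hx, hσ0 _ hxh]) (fun t ht => ?_) 1 (by simp)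
    · have hw1 : w 1 = -(σ (x + h) 1 - σ x 1 - A (a + x) h (σ x 1)) := by
        simp only [w, one_smul]; abel
      rw [hw1, norm_neg] at hgr
      refine hgr.trans (le_of_eq ?_)
      rw [hκ, sub_zero, gronwallBound_of_K_ne_0 hK1, gronwallBound_of_K_ne_0 hK1]
      ring
    · have ht' : t ∈ Icc (0 : ℝ) 1 := ⟨ht.1, ht.2.le⟩
      have hy := add_smul_mem_ball hx ht'
      have hz := add_smul_mem_ball hxh ht'
      have hR := norm_sub_sub_le_of_lipschitz_fderiv (convex_ball a ρ) hD hDL hK0 hy hz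
      have hyz : a + t • (x + h) - (a + t • x) = t • h := by rw [smul_add]; abel
      rw [hyz] at hR
      have happ := norm_approx_radial_le ht' (hAK _ hy) (hDK _ hy) hR hxh1 hh (hm t ht')
        (hflat x hx t ht' h)
      have hsplit : w' t = ((A (a + t • x) x (σ x t) + (A (a + t • x) h (σ x t)
          + t • (D (a + t • x) x h (σ x t) + A (a + t • x) h (A (a + t • x) x (σ x t)))))
          - A (a + t • (x + h)) (x + h) (σ x t + t • A (a + t • x) h (σ x t)))
          + A (a + t • (x + h)) (x + h) (w t) := by
        simp only [w', w]
        rw [map_sub (A (a + t • (x + h)) (x + h)) _ (σ (x + h) t)]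
        abel
      rw [hsplit, add_comm]
      refine (norm_add_le _ _).trans (add_le_add ?_ happ)
      calc _ ≤ K * 1 * ‖w t‖ :=
            (A (a + t • (x + h))).le_of_opNorm₂_le_of_le (hAK _ hz) hxh1 le_rfl
        _ ≤ (K + 1) * ‖w t‖ := by gcongr; linarith
  rw [hasFDerivAt_iff_isLittleO_nhds_zero]
  refine Asymptotics.IsBigO.trans_isLittleO (g := fun h : V => ‖h‖ ^ 2) ?_ ?_
  · refine Asymptotics.IsBigO.of_bound κ ?_
    have hnear : ∀ᶠ h in 𝓝 (0 : V), a + (x + h) ∈ ball a ρ := by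
      have hc : Continuous fun h : V => a + (x + h) := by fun_prop
      exact hc.continuousAt.eventually_mem (isOpen_ball.mem_nhds (by simpa using hx))
    filter_upwards [hnear] with h hh
    rw [Real.norm_of_nonneg (by positivity)]
    exact main h hh
  · exact (Asymptotics.isLittleO_norm_pow_id one_lt_two)

end LinearTotalEquation

/-! ### Parallel fields of operators for a field of projections -/

section ProjectionField

open Set Metric Filter Topology

variable {V : Type*} [NormedAddCommGroup V] [NormedSpace ℝ V]
  {E : Type*} [NormedAddCommGroup E] [NormedSpace ℝ E]

/-- The derivative of the identity `P² = P`: `dP P + P dP = dP`. -/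
lemma fderiv_idempotent_apply {P : V → E →L[ℝ] E} {y : V} (hP : DifferentiableAt ℝ P y)
    (hid : ∀ᶠ z in 𝓝 y, ∀ e, P z (P z e) = P z e) (v : V) (e : E) :
    fderiv ℝ P y v (P y e) + P y (fderiv ℝ P y v e) = fderiv ℝ P y v e := by
  have h1 : HasFDerivAt (fun z => P z e) ((fderiv ℝ P y).flip e) y := by
    simpa using hP.hasFDerivAt.clm_apply (hasFDerivAt_const e y)
  have h2 := hP.hasFDerivAt.clm_apply h1
  have h3 : HasFDerivAt (fun z => P z e) _ y :=
    h2.congr_of_eventuallyEq (hid.mono fun z hz => (hz e).symm)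
  have := congrArg (fun T : V →L[ℝ] E => T v) (h3.unique h1)
  simpa [add_comm] using this

/-- The derivative of a field of idempotents `P` maps the range of `P` into the kernel of `P`. -/
lemma idempotent_apply_fderiv_apply {P : V → E →L[ℝ] E} {y : V} (hP : DifferentiableAt ℝ P y)
    (hid : ∀ᶠ z in 𝓝 y, ∀ e, P z (P z e) = P z e) (v : V) (e : E) :
    P y (fderiv ℝ P y v (P y e)) = 0 := by
  have h := congrArg (P y) (fderiv_idempotent_apply hP hid v e)
  have hy := hid.self_of_nhds
  rw [map_add, hy] at h
  exact add_eq_right.mp h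

/-- Bootstrapping: a solution of `dS = dP ∘ S` with smooth `P` is smooth. -/
lemma contDiffOn_of_hasFDerivAt_comp {P S : V → E →L[ℝ] E} {B : Set V} (hB : IsOpen B)
    (hP : ContDiffOn ℝ ∞ P B)
    (hS : ∀ y ∈ B, HasFDerivAt S
      (((ContinuousLinearMap.compL ℝ E E E).flip (S y)).comp (fderiv ℝ P y)) y) :
    ContDiffOn ℝ ∞ S B := by
  rw [contDiffOn_infty]
  intro n
  induction n with
  | zero => exact contDiffOn_zero.2 fun y hy => (hS y hy).continuousAt.continuousWithinAt
  | succ n ih =>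
    push_cast
    rw [contDiffOn_succ_iff_fderiv_of_isOpen hB]
    refine ⟨fun y hy => (hS y hy).differentiableAt.differentiableWithinAt, by simp, ?_⟩
    have h1 : ContDiffOn ℝ n (fderiv ℝ P) B :=
      hP.fderiv_of_isOpen hB (by norm_cast; exact le_top)
    have h2 : ContDiffOn ℝ n (fun y => (ContinuousLinearMap.compL ℝ E E E).flip (S y)) B :=
      ((ContinuousLinearMap.compL ℝ E E E).flip).contDiff.comp_contDiffOn ih
    exact (h2.clm_comp h1).congr fun y hy => (hS y hy).fderiv

/-- Uniqueness for the equation `ds = dP s`: a solution that vanishes at `a` vanishes on a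
neighbourhood of `a` that does not depend on the solution. -/
lemma exists_nhds_forall_eq_zero_of_hasFDerivAt {P : V → E →L[ℝ] E} {a : V}
    (hP : ContDiffAt ℝ 1 P a) {O : Set V} (hO : O ∈ 𝓝 a) :
    ∃ N ∈ 𝓝 a, ∀ s : V → E, (∀ y ∈ O, HasFDerivAt s ((fderiv ℝ P y).flip (s y)) y) → s a = 0 →
      ∀ y ∈ N, s y = 0 := by
  have hc : ContinuousAt (fderiv ℝ P) a := (hP.fderiv_right (m := 0) le_rfl).continuousAt
  have hb : ∀ᶠ y in 𝓝 a, ‖fderiv ℝ P y‖ ≤ ‖fderiv ℝ P a‖ + 1 :=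
    (hc.norm.eventually_lt_const (lt_add_one _)).mono fun y hy => hy.le
  obtain ⟨ρ, hρ, h⟩ := Metric.eventually_nhds_iff_ball.1 (hb.and hO)
  exact ⟨ball a ρ, ball_mem_nhds a hρ, fun s hs h0 => eq_zero_of_hasFDerivAt_linear
    (A := fderiv ℝ P) (fun y hy => (h y hy).1) (fun y hy => hs y (h y hy).2) h0⟩

/-- The differential equation `dS = dP ∘ S` for parallel fields of operators is integrable near `a`
as soon as `dP(u)` and `dP(v)` commute on the range of `P`. -/
theorem exists_parallel_operator_field [CompleteSpace E] {P : V → E →L[ℝ] E} {Ω : Set V}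
    (hΩ : IsOpen Ω) (hP : ContDiffOn ℝ ∞ P Ω) (hid : ∀ y ∈ Ω, ∀ e, P y (P y e) = P y e)
    (hflat : ∀ y ∈ Ω, ∀ u v e,
      fderiv ℝ P y u (fderiv ℝ P y v (P y e)) = fderiv ℝ P y v (fderiv ℝ P y u (P y e)))
    {a : V} (ha : a ∈ Ω) :
    ∃ B ⊆ Ω, IsOpen B ∧ a ∈ B ∧ ∃ S : V → E →L[ℝ] E, S a = P a ∧
      ContDiffOn ℝ ∞ S B ∧ (∀ y ∈ B, ∀ e, P y (S y e) = S y e) ∧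
      ∀ y ∈ B, ∀ u e, P y (fderiv ℝ S y u e) = 0 := by
  set L := ContinuousLinearMap.compL ℝ E E E with hL
  -- The equation in the form `dS = A S`.
  set A : V → V →L[ℝ] (E →L[ℝ] E) →L[ℝ] (E →L[ℝ] E) := fun y => L.comp (fderiv ℝ P y) with hA
  have hAapp : ∀ y u T, A y u T = (fderiv ℝ P y u).comp T := fun _ _ _ => rfl
  have hP1 : ContDiffOn ℝ ∞ (fderiv ℝ P) Ω := hP.fderiv_of_isOpen hΩ (by simp)
  have hAs : ContDiffOn ℝ ∞ A Ω :=
    ((ContinuousLinearMap.compL ℝ V (E →L[ℝ] E) ((E →L[ℝ] E) →L[ℝ] (E →L[ℝ] E)) L).contDiff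
      ).comp_contDiffOn hP1
  have hDs : ContDiffOn ℝ ∞ (fderiv ℝ A) Ω := hAs.fderiv_of_isOpen hΩ (by simp)
  have hΩa := hΩ.mem_nhds ha
  have hAc : ContinuousAt A a := (hAs.contDiffAt hΩa).continuousAt
  have hDc : ContinuousAt (fderiv ℝ A) a := (hDs.contDiffAt hΩa).continuousAt
  obtain ⟨K₀, t, ht, hlip⟩ := ((hDs.contDiffAt hΩa).of_le (by simp) : ContDiffAt ℝ 1 (fderiv ℝ A) a
    ).exists_lipschitzOnWith
  set K : ℝ := max (K₀ : ℝ) (max (‖A a‖ + 1) (‖fderiv ℝ A a‖ + 1)) with hK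
  have hK0 : 0 < K := lt_of_lt_of_le (by positivity) ((le_max_left _ _).trans (le_max_right _ _))
  have hev : ∀ᶠ y in 𝓝 a, y ∈ Ω ∧ y ∈ t ∧ ‖A y‖ ≤ K ∧ ‖fderiv ℝ A y‖ ≤ K := by
    filter_upwards [hΩa, ht, hAc.norm.eventually_lt_const (lt_add_one _),
      (ContinuousAt.norm (E := V →L[ℝ] V →L[ℝ] (E →L[ℝ] E) →L[ℝ] E →L[ℝ] E) hDc
        ).eventually_lt_const (lt_add_one _)] with y h1 h2 h3 h4
    exact ⟨h1, h2, h3.le.trans ((le_max_left _ _).trans (le_max_right _ _)),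
      h4.le.trans ((le_max_right _ _).trans (le_max_right _ _))⟩
  obtain ⟨ρ₀, hρ₀, hball⟩ := Metric.eventually_nhds_iff_ball.1 hev
  set ρ := min ρ₀ (min 1 (1 / 2 / K)) with hρdef
  have hρ : 0 < ρ := by positivity
  have hρ1 : ρ ≤ 1 := (min_le_right _ _).trans (min_le_left _ _)
  have hKρ : K * ρ ≤ 1 / 2 := by
    have : ρ ≤ 1 / 2 / K := (min_le_right _ _).trans (min_le_right _ _)
    rw [le_div_iff₀ hK0] at this
    linarith
  replace hball : ∀ y ∈ ball a ρ, y ∈ Ω ∧ y ∈ t ∧ ‖A y‖ ≤ K ∧ ‖fderiv ℝ A y‖ ≤ K := fun y hy =>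
    hball y (ball_subset_ball (min_le_left _ _) hy)
  have hBΩ : ball a ρ ⊆ Ω := fun y hy => (hball y hy).1
  have hdiffA : ∀ y ∈ Ω, DifferentiableAt ℝ A y := fun y hy =>
    (hAs.contDiffAt (hΩ.mem_nhds hy)).differentiableAt (by simp)
  have hdiffP : ∀ y ∈ Ω, DifferentiableAt ℝ P y := fun y hy =>
    (hP.contDiffAt (hΩ.mem_nhds hy)).differentiableAt (by simp)
  have hdiffP1 : ∀ y ∈ Ω, DifferentiableAt ℝ (fderiv ℝ P) y := fun y hy =>
    (hP1.contDiffAt (hΩ.mem_nhds hy)).differentiableAt (by simp)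
  have hidn : ∀ y ∈ Ω, ∀ᶠ z in 𝓝 y, ∀ e, P z (P z e) = P z e := fun y hy =>
    (hΩ.eventually_mem hy).mono fun z hz => hid z hz
  have hDapp : ∀ y ∈ Ω, ∀ u v T,
      fderiv ℝ A y u v T = (fderiv ℝ (fderiv ℝ P) y u v).comp T := by
    intro y hy u v T
    have h1 : HasFDerivAt A ((ContinuousLinearMap.compL ℝ V (E →L[ℝ] E)
        ((E →L[ℝ] E) →L[ℝ] (E →L[ℝ] E)) L).comp (fderiv ℝ (fderiv ℝ P) y)) y :=
      (ContinuousLinearMap.compL ℝ V (E →L[ℝ] E)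
        ((E →L[ℝ] E) →L[ℝ] (E →L[ℝ] E)) L).hasFDerivAt.comp y (hdiffP1 y hy).hasFDerivAt
    rw [h1.fderiv]
    rfl
  have hex : ∀ x, ∃ σ : ℝ → E →L[ℝ] E, a + x ∈ ball a ρ → σ 0 = P a ∧ ∀ t ∈ Icc (0 : ℝ) 1,
      HasDerivWithinAt σ (A (a + t • x) x (σ t)) (Icc 0 1) t := by
    intro x
    by_cases hx : a + x ∈ ball a ρ
    · obtain ⟨σ, h⟩ := exists_radial_solution (hAs.continuousOn.mono hBΩ)
        (fun y hy => (hball y hy).2.2.1) hKρ (P a) hx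
      exact ⟨σ, fun _ => h⟩
    · exact ⟨0, fun h => absurd h hx⟩
  choose σ hσ using hex
  -- Along the radii the solution takes values in the ranges of `P`.
  have hPσ : ∀ x, a + x ∈ ball a ρ → ∀ t ∈ Icc (0 : ℝ) 1,
      (P (a + t • x)).comp (σ x t) = σ x t := by
    intro x hx t ht
    obtain ⟨h0, hd⟩ := hσ x hx
    let w : ℝ → E →L[ℝ] E := fun t => (P (a + t • x)).comp (σ x t) - σ x t
    have hw : ∀ t ∈ Icc (0 : ℝ) 1, HasDerivWithinAt w
        (-(fderiv ℝ P (a + t • x) x).comp (w t)) (Icc 0 1) t := by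
      intro t ht
      have hy := hBΩ (add_smul_mem_ball hx ht)
      have hl : HasDerivAt (fun t : ℝ => a + t • x) x t := by
        simpa using ((hasDerivAt_id t).smul_const x).const_add a
      have h1 : HasDerivAt (fun t : ℝ => P (a + t • x)) (fderiv ℝ P (a + t • x) x) t :=
        (hdiffP _ hy).hasFDerivAt.comp_hasDerivAt t hl
      have h2 := ((h1.hasDerivWithinAt (s := Icc 0 1)).clm_comp (hd t ht)).sub (hd t ht)
      refine h2.congr_deriv ?_
      ext e
      have h3 := fderiv_idempotent_apply (hdiffP _ hy) (hidn _ hy) x (σ x t e)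
      simp only [hAapp, w, sub_apply, add_apply, neg_apply,
        ContinuousLinearMap.comp_apply, map_sub]
      rw [← sub_eq_zero] at h3 ⊢
      refine Eq.trans ?_ h3
      abel
    have := eq_zero_of_abs_deriv_le_mul_abs_self_of_eq_zero_right (K := K * ‖x‖)
      (f := w) (a := 0) (b := 1)
      (fun t ht => (hw t ht).continuousWithinAt)
      (fun t ht => (hw t ⟨ht.1, ht.2.le⟩).mono_of_mem_nhdsWithin (Icc_mem_nhdsGE_of_mem ht))
      (by
        ext e
        simp [w, h0, hid a ha])
      (fun t ht => by
        rw [norm_neg]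
        change ‖A (a + t • x) x (w t)‖ ≤ _
        exact (A (a + t • x)).le_of_opNorm₂_le_of_le
          (hball _ (add_smul_mem_ball hx ⟨ht.1, ht.2.le⟩)).2.2.1 le_rfl le_rfl) t ht
    exact sub_eq_zero.1 this
  have hfd : ∀ x, a + x ∈ ball a ρ →
      HasFDerivAt (fun z => σ z 1) ((A (a + x)).flip (σ x 1)) x := by
    intro x hx
    refine hasFDerivAt_radial_solution (D := fderiv ℝ A) hρ1
      (fun y hy => (hdiffA y (hBΩ hy)).hasFDerivAt)
      (fun y hy => (hball y hy).2.2.1) (fun y hy => (hball y hy).2.2.2)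
      (fun y hy z hz => ?_) (fun x hx => (hσ x hx).1) (fun x hx => (hσ x hx).2) ?_ hx
    · have := hlip.dist_le_mul y (hball y hy).2.1 z (hball z hz).2.1
      rw [dist_eq_norm, dist_eq_norm] at this
      refine this.trans ?_
      gcongr
      exact le_max_left _ _
    · intro x hx t ht h
      have hy := hBΩ (add_smul_mem_ball hx ht)
      rw [hDapp _ hy, hDapp _ hy]
      have hsymm : IsSymmSndFDerivAt ℝ P (a + t • x) :=
        (hP.contDiffAt (hΩ.mem_nhds hy)).isSymmSndFDerivAt (by
          rw [minSmoothness_of_isRCLikeNormedField]; exact WithTop.coe_le_coe.2 (le_top : (2 : ℕ∞) ≤ ⊤))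
      rw [hsymm.eq x h]
      congr 1
      ext e
      have h1 : σ x t e = P (a + t • x) (σ x t e) :=
        (congrArg (fun T : E →L[ℝ] E => T e) (hPσ x hx t ht)).symm
      simp only [hAapp, ContinuousLinearMap.comp_apply]
      rw [h1]
      exact hflat _ hy h x _
  have hmem : ∀ y ∈ ball a ρ, a + (y - a) ∈ ball a ρ := fun y hy => by simpa using hy
  have hS : ∀ y ∈ ball a ρ, HasFDerivAt (fun y => σ (y - a) 1) ((A y).flip (σ (y - a) 1)) y := by
    intro y hy
    have h1 := hfd (y - a) (hmem y hy)
    rw [add_sub_cancel] at h1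
    exact h1.comp y ((hasFDerivAt_id y).sub_const a)
  have hPS : ∀ y ∈ ball a ρ, ∀ e, P y (σ (y - a) 1 e) = σ (y - a) 1 e := by
    intro y hy e
    have := congrArg (fun T : E →L[ℝ] E => T e) (hPσ (y - a) (hmem y hy) 1 (by simp))
    simpa using this
  refine ⟨ball a ρ, hBΩ, isOpen_ball, mem_ball_self hρ, fun y => σ (y - a) 1, ?_,
    contDiffOn_of_hasFDerivAt_comp isOpen_ball (hP.mono hBΩ) hS, hPS, ?_⟩
  -- On the constant radius the right-hand side of the equation vanishes.
  · have h0 : a + (0 : V) ∈ ball a ρ := by simpa using hρ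
    have h1 := (constant_of_has_deriv_right_zero (f := σ 0) (a := 0) (b := 1)
      (fun t ht => ((hσ 0 h0).2 t ht).continuousWithinAt)
      (fun t ht => by
        have := ((hσ 0 h0).2 t ⟨ht.1, ht.2.le⟩).mono_of_mem_nhdsWithin (Icc_mem_nhdsGE_of_mem ht)
        simpa using this)) 1 (by simp)
    simpa [(hσ 0 h0).1] using h1
  · intro y hy u e
    rw [(hS y hy).fderiv, ContinuousLinearMap.flip_apply, hAapp, ContinuousLinearMap.comp_apply,
      ← hPS y hy e]
    exact idempotent_apply_fderiv_apply (hdiffP y (hBΩ hy)) (hidn y (hBΩ hy)) u _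

end ProjectionField

/-! ### Locally constant cocycles on simply connected spaces -/

section Monodromy

open Set Filter Topology

/-- On a simply connected, locally path connected space every locally constant cocycle `c` with
values in a group is a coboundary. The cocycle glues a principal covering, and a section of this
covering is a lift of the identity map. -/
theorem exists_coboundary_of_locally_constant_cocycle {B G : Type*} [TopologicalSpace B]
    [SimplyConnectedSpace B] [LocallyPathConnectedSpace B] [Group G] {U : B → Set B}
    (hU : ∀ i, IsOpen (U i)) (hmem : ∀ i, i ∈ U i) {c : B → B → B → G}
    (hself : ∀ i, ∀ x ∈ U i, c i i x = 1)
    (hcomp : ∀ i j k, ∀ x ∈ U i ∩ U j ∩ U k, c j k x * c i j x = c i k x)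
    (hloc : ∀ i j, ∀ x ∈ U i ∩ U j, ∀ᶠ y in 𝓝 x, c i j y = c i j x) :
    ∃ f : B → B → G, (∀ i, ∀ x ∈ U i, ∀ᶠ y in 𝓝 x, f i y = f i x) ∧
      ∀ i j, ∀ x ∈ U i ∩ U j, f j x = c i j x * f i x := by
  let _ : TopologicalSpace G := ⊥
  have _ : DiscreteTopology G := ⟨rfl⟩
  let Z : FiberBundleCore B B G :=
    { baseSet := U
      isOpen_baseSet := hU
      indexAt := id
      mem_baseSet_at := hmem
      coordChange := fun i j x g => c i j x * g
      coordChange_self := fun i x hx g => by rw [hself i x hx, one_mul]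
      continuousOn_coordChange := fun i j p hp => by
        have h1 : ContinuousAt (fun x => c i j x) p.1 :=
          continuousAt_const.congr ((hloc i j p.1 hp.1).mono fun y hy => hy.symm)
        have h2 : ContinuousAt (fun p : B × G => c i j p.1) p :=
          ContinuousAt.comp (f := Prod.fst) h1 continuousAt_fst
        have h3 : Continuous fun q : G × G => q.1 * q.2 := continuous_of_discreteTopology
        exact (h3.continuousAt.comp (h2.prodMk continuousAt_snd)).continuousWithinAt
      coordChange_comp := fun i j k x hx g => by rw [← mul_assoc, hcomp i j k x hx] }
  have hcov : IsCoveringMap Z.proj := FiberBundle.isCoveringMap (F := G) (E := Z.Fiber)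
  obtain ⟨b₀⟩ : Nonempty B := inferInstance
  obtain ⟨s, ⟨-, hs⟩, -⟩ := hcov.existsUnique_continuousMap_lifts (ContinuousMap.id B) b₀
    (⟨b₀, (1 : G)⟩ : Z.TotalSpace) rfl
  have hs1 : ∀ x, (s x).1 = x := fun x => congrFun hs x
  let g : B → G := fun x => (s x).2
  have key : ∀ i x, (Z.localTriv i (s x)).2 = c x i x * g x := fun i x => by
    have h := congrArg Prod.snd (Z.localTriv_apply i (s x))
    refine h.trans ?_
    change c (s x).1 i (s x).1 * g x = _
    rw [hs1 x]
  refine ⟨fun i x => (Z.localTriv i (s x)).2, fun i x hx => ?_, fun i j x hx => ?_⟩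
  · have hsrc : s x ∈ (Z.localTriv i).source := by
      rw [Z.mem_localTriv_source, ← Z.baseSet_at, hs1 x]
      exact hx
    have hc : ContinuousAt (fun x => (Z.localTriv i (s x)).2) x :=
      continuousAt_snd.comp (((Z.localTriv i).continuousAt hsrc).comp s.continuous.continuousAt)
    exact hc.eventually_mem ((isOpen_discrete {(Z.localTriv i (s x)).2}).mem_nhds rfl)
  · change (Z.localTriv j (s x)).2 = c i j x * (Z.localTriv i (s x)).2
    rw [key, key, ← mul_assoc, hcomp x i j x ⟨⟨hmem x, hx.1⟩, hx.2⟩]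

end Monodromy

/-! ### Differentials of vector-valued maps on a manifold -/

section Differential

open Set Filter Topology VectorField

variable {r : ℕ} {M : Type*} [TopologicalSpace M] [ChartedSpace (EuclideanSpace ℝ (Fin r)) M]
  {G : Type*} [NormedAddCommGroup G] [NormedSpace ℝ G]

/-- The differential at `x` of a map from `M` to a vector space, with the tangent spaces replaced
by the model spaces to which they are definitionally equal. -/
noncomputable def differential (r : ℕ) {M : Type*} [TopologicalSpace M]
    [ChartedSpace (EuclideanSpace ℝ (Fin r)) M] {G : Type*} [NormedAddCommGroup G] [NormedSpace ℝ G]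
    (f : M → G) (x : M) : EuclideanSpace ℝ (Fin r) →L[ℝ] G :=
  mfderiv (𝓡 r) 𝓘(ℝ, G) f x

/-- The differential at `y` of the inverse of the chart centred at `x₀`. -/
noncomputable def chartSymmDifferential (r : ℕ) {M : Type*} [TopologicalSpace M]
    [ChartedSpace (EuclideanSpace ℝ (Fin r)) M] (x₀ : M) (y : EuclideanSpace ℝ (Fin r)) :
    EuclideanSpace ℝ (Fin r) →L[ℝ] EuclideanSpace ℝ (Fin r) :=
  mfderiv 𝓘(ℝ, EuclideanSpace ℝ (Fin r)) (𝓡 r) (extChartAt (𝓡 r) x₀).symm y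

lemma differential_congr {f g : M → G} {x : M} (h : f =ᶠ[𝓝 x] g) :
    differential r f x = differential r g x :=
  h.mfderiv_eq

lemma differential_const (c : G) (x : M) : differential r (fun _ : M => c) x = 0 :=
  mfderiv_const

lemma differential_add {f g : M → G} {x : M} (hf : MDifferentiableAt (𝓡 r) 𝓘(ℝ, G) f x)
    (hg : MDifferentiableAt (𝓡 r) 𝓘(ℝ, G) g x) :
    differential r (fun y => f y + g y) x = differential r f x + differential r g x :=
  mfderiv_add hf hg

lemma differential_sub {f g : M → G} {x : M} (hf : MDifferentiableAt (𝓡 r) 𝓘(ℝ, G) f x)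
    (hg : MDifferentiableAt (𝓡 r) 𝓘(ℝ, G) g x) :
    differential r (fun y => f y - g y) x = differential r f x - differential r g x :=
  mfderiv_sub hf hg

variable [IsManifold (𝓡 r) ∞ M]

lemma bijective_chartSymmDifferential {x₀ : M} {y : EuclideanSpace ℝ (Fin r)}
    (hy : y ∈ (extChartAt (𝓡 r) x₀).target) :
    Function.Bijective (chartSymmDifferential r x₀ y) := by
  have h := isInvertible_mfderivWithin_extChartAt_symm (I := 𝓡 r) hy
  rw [ModelWithCorners.range_eq_univ, mfderivWithin_univ] at h
  exact h.bijective

lemma fderiv_comp_extChartAt_symm {f : M → G} {x₀ : M} {y : EuclideanSpace ℝ (Fin r)}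
    (hy : y ∈ (extChartAt (𝓡 r) x₀).target)
    (hf : MDifferentiableAt (𝓡 r) 𝓘(ℝ, G) f ((extChartAt (𝓡 r) x₀).symm y)) :
    fderiv ℝ (f ∘ (extChartAt (𝓡 r) x₀).symm) y
      = (differential r f ((extChartAt (𝓡 r) x₀).symm y)).comp (chartSymmDifferential r x₀ y) := by
  have h := mdifferentiableWithinAt_extChartAt_symm (I := 𝓡 r) hy
  rw [ModelWithCorners.range_eq_univ, mdifferentiableWithinAt_univ] at h
  rw [← mfderiv_eq_fderiv]
  exact mfderiv_comp y hf h

lemma differentiableAt_comp_extChartAt_symm {f : M → G} {x₀ : M} {y : EuclideanSpace ℝ (Fin r)}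
    (hy : y ∈ (extChartAt (𝓡 r) x₀).target)
    (hf : MDifferentiableAt (𝓡 r) 𝓘(ℝ, G) f ((extChartAt (𝓡 r) x₀).symm y)) :
    DifferentiableAt ℝ (f ∘ (extChartAt (𝓡 r) x₀).symm) y := by
  have h := mdifferentiableWithinAt_extChartAt_symm (I := 𝓡 r) hy
  rw [ModelWithCorners.range_eq_univ, mdifferentiableWithinAt_univ] at h
  rw [← mdifferentiableAt_iff_differentiableAt]
  exact MDifferentiableAt.comp y hf h

lemma differential_clm_apply {E : Type*} [NormedAddCommGroup E] [NormedSpace ℝ E]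
    {P : M → E →L[ℝ] G} {s : M → E} {x : M}
    (hP : MDifferentiableAt (𝓡 r) 𝓘(ℝ, E →L[ℝ] G) P x)
    (hs : MDifferentiableAt (𝓡 r) 𝓘(ℝ, E) s x) (u : EuclideanSpace ℝ (Fin r)) :
    differential r (fun y => P y (s y)) x u
      = differential r P x u (s x) + P x (differential r s x u) := by
  have hy := mem_extChartAt_target (I := 𝓡 r) x
  have hx : (extChartAt (𝓡 r) x).symm (extChartAt (𝓡 r) x x) = x := extChartAt_to_inv x
  have hPs : MDifferentiableAt (𝓡 r) 𝓘(ℝ, G) (fun y => P y (s y)) x := hP.clm_apply hs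
  rw [← hx] at hP hs hPs
  obtain ⟨w, rfl⟩ := (bijective_chartSymmDifferential hy).2 u
  have h := fderiv_clm_apply (differentiableAt_comp_extChartAt_symm hy hP)
    (differentiableAt_comp_extChartAt_symm hy hs)
  have h1 := congrArg (fun T : EuclideanSpace ℝ (Fin r) →L[ℝ] G => T w)
    ((fderiv_comp_extChartAt_symm hy hPs).symm.trans h)
  rw [fderiv_comp_extChartAt_symm hy hP, fderiv_comp_extChartAt_symm hy hs] at h1
  simpa [hx, add_comm] using h1

lemma contDiffOn_comp_extChartAt_symm {f : M → G} {W : Set M} {n : WithTop ℕ∞} (hn : n ≤ ∞)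
    (hf : ContMDiffOn (𝓡 r) 𝓘(ℝ, G) n f W) (x₀ : M) :
    ContDiffOn ℝ n (f ∘ (extChartAt (𝓡 r) x₀).symm)
      ((extChartAt (𝓡 r) x₀).target ∩ (extChartAt (𝓡 r) x₀).symm ⁻¹' W) := by
  rw [← contMDiffOn_iff_contDiffOn]
  exact hf.comp (((contMDiffOn_extChartAt_symm (n := ∞) x₀).of_le hn).mono inter_subset_left)
    inter_subset_right

omit [IsManifold (𝓡 r) ∞ M] in
lemma isOpen_extChartAt_target_inter_preimage {W : Set M} (hW : IsOpen W) (x₀ : M) :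
    IsOpen ((extChartAt (𝓡 r) x₀).target ∩ (extChartAt (𝓡 r) x₀).symm ⁻¹' W) :=
  (continuousOn_extChartAt_symm x₀).isOpen_inter_preimage (isOpen_extChartAt_target x₀) hW

lemma contMDiffOn_comp_extChartAt {g : EuclideanSpace ℝ (Fin r) → G}
    {B : Set (EuclideanSpace ℝ (Fin r))} (hg : ContDiffOn ℝ ∞ g B) (x₀ : M) :
    ContMDiffOn (𝓡 r) 𝓘(ℝ, G) ∞ (g ∘ extChartAt (𝓡 r) x₀)
      ((extChartAt (𝓡 r) x₀).source ∩ extChartAt (𝓡 r) x₀ ⁻¹' B) := by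
  rw [← contMDiffOn_iff_contDiffOn] at hg
  refine hg.comp (contMDiffOn_extChartAt.mono ?_) inter_subset_right
  rw [extChartAt_source]
  exact inter_subset_left

lemma contMDiffOn_differential_apply {f : M → G} {W : Set M} (hW : IsOpen W)
    (hf : ContMDiffOn (𝓡 r) 𝓘(ℝ, G) ∞ f W) {v : Π x : M, TangentSpace (𝓡 r) x}
    (hv : ContMDiffOn (𝓡 r) (𝓡 r).tangent ∞ (fun x => (⟨x, v x⟩ : TangentBundle (𝓡 r) M)) W) :
    ContMDiffOn (𝓡 r) 𝓘(ℝ, G) ∞ (fun x => differential r f x (v x)) W := by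
  have h1 := hf.contMDiffOn_tangentMapWithin (m := ∞) (by simp) hW.uniqueMDiffOn
  have h2 := h1.comp hv fun x hx => hx
  have h3 := (contMDiff_snd_tangentBundle_modelSpace G 𝓘(ℝ, G) (n := ∞)).comp_contMDiffOn h2
  refine h3.congr fun x hx => ?_
  change _ = mfderivWithin (𝓡 r) 𝓘(ℝ, G) f W x (v x)
  rw [mfderivWithin_of_isOpen hW hx]
  rfl

/-- The Lie bracket of vector fields is the commutator of the derivations of (vector-valued)
functions that they define. -/
lemma differential_mlieBracket {f : M → G} {W : Set M} (hW : IsOpen W)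
    (hf : ContMDiffOn (𝓡 r) 𝓘(ℝ, G) ∞ f W) {u v : Π x : M, TangentSpace (𝓡 r) x}
    (hu : ContMDiffOn (𝓡 r) (𝓡 r).tangent ∞ (fun x => (⟨x, u x⟩ : TangentBundle (𝓡 r) M)) W)
    (hv : ContMDiffOn (𝓡 r) (𝓡 r).tangent ∞ (fun x => (⟨x, v x⟩ : TangentBundle (𝓡 r) M)) W)
    {x : M} (hx : x ∈ W) :
    differential r f x (mlieBracket (𝓡 r) u v x) =
      differential r (fun y => differential r f y (v y)) x (u x)
      - differential r (fun y => differential r f y (u y)) x (v x) := by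
  set φ := extChartAt (𝓡 r) x with hφ
  have hy₀ : φ x ∈ φ.target := mem_extChartAt_target x
  have hφx : φ.symm (φ x) = x := extChartAt_to_inv x
  set O := φ.target ∩ φ.symm ⁻¹' W with hO
  have hOo : IsOpen O := isOpen_extChartAt_target_inter_preimage hW x
  have hyO : φ x ∈ O := ⟨hy₀, by rw [mem_preimage, hφx]; exact hx⟩
  have hmd : ∀ {g : M → G}, ContMDiffOn (𝓡 r) 𝓘(ℝ, G) ∞ g W → ∀ y ∈ O,
      MDifferentiableAt (𝓡 r) 𝓘(ℝ, G) g (φ.symm y) := fun hg y hy =>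
    (hg.contMDiffAt (hW.mem_nhds hy.2)).mdifferentiableAt (by simp)
  have hF : ContDiffOn ℝ ∞ (f ∘ φ.symm) O := contDiffOn_comp_extChartAt_symm le_rfl hf x
  have hF' : ContDiffAt ℝ ∞ (f ∘ φ.symm) (φ x) := hF.contDiffAt (hOo.mem_nhds hyO)
  -- `pull w` is the vector field `w` read in the chart centred at `x`.
  let pull : (Π x : M, TangentSpace (𝓡 r) x) → EuclideanSpace ℝ (Fin r) → EuclideanSpace ℝ (Fin r) :=
    fun w => mpullbackWithin 𝓘(ℝ, EuclideanSpace ℝ (Fin r)) (𝓡 r) φ.symm w (range (𝓡 r))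
  have hpull : ∀ w, ∀ y ∈ φ.target, chartSymmDifferential r x y (pull w y) = w (φ.symm y) := by
    intro w y hy
    have h := isInvertible_mfderivWithin_extChartAt_symm (I := 𝓡 r) hy
    have h1 : mfderivWithin 𝓘(ℝ, EuclideanSpace ℝ (Fin r)) (𝓡 r) φ.symm (range (𝓡 r)) y
        (pull w y) = w (φ.symm y) := h.self_apply_inverse _
    rw [ModelWithCorners.range_eq_univ, mfderivWithin_univ] at h1
    exact h1
  have hpd : ∀ {w : Π x : M, TangentSpace (𝓡 r) x},
      ContMDiffOn (𝓡 r) (𝓡 r).tangent ∞ (fun x => (⟨x, w x⟩ : TangentBundle (𝓡 r) M)) W →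
      DifferentiableAt ℝ (pull w) (φ x) := by
    intro w hw
    have h1 := ((hw.contMDiffAt (hW.mem_nhds hx)).mdifferentiableAt (by simp)
      ).mdifferentiableWithinAt (s := univ)
    have h2 : DifferentiableWithinAt ℝ (pull w) (φ.symm ⁻¹' univ ∩ range (𝓡 r)) (φ x) :=
      MDifferentiableWithinAt.differentiableWithinAt_mpullbackWithin_vectorField h1
    rwa [preimage_univ, univ_inter, ModelWithCorners.range_eq_univ,
      differentiableWithinAt_univ] at h2
  have hder : ∀ {w z : Π x : M, TangentSpace (𝓡 r) x},
      ContMDiffOn (𝓡 r) (𝓡 r).tangent ∞ (fun x => (⟨x, w x⟩ : TangentBundle (𝓡 r) M)) W →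
      differential r (fun y => differential r f y (w y)) x (z x)
        = fderiv ℝ (fderiv ℝ (f ∘ φ.symm)) (φ x) (pull z (φ x)) (pull w (φ x))
          + fderiv ℝ (f ∘ φ.symm) (φ x) (fderiv ℝ (pull w) (φ x) (pull z (φ x))) := by
    intro w z hw
    have h1 : (fun y => differential r f y (w y)) ∘ φ.symm =ᶠ[𝓝 (φ x)]
        fun y => fderiv ℝ (f ∘ φ.symm) y (pull w y) := by
      filter_upwards [hOo.mem_nhds hyO] with y hy
      rw [fderiv_comp_extChartAt_symm hy.1 (hmd hf y hy), ContinuousLinearMap.comp_apply,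
        hpull w y hy.1]
      rfl
    have h2 := fderiv_comp_extChartAt_symm hy₀
      (hmd (contMDiffOn_differential_apply hW hf hw) _ hyO)
    have h3 := congrArg (fun T : EuclideanSpace ℝ (Fin r) →L[ℝ] G => T (pull z (φ x))) h2
    simp only [ContinuousLinearMap.comp_apply] at h3
    rw [hpull z _ hy₀, hφx] at h3
    have hd1 : DifferentiableAt ℝ (fderiv ℝ (f ∘ φ.symm)) (φ x) :=
      (hF'.fderiv_right (m := 1) (WithTop.coe_le_coe.2 le_top)).differentiableAt (by simp)
    rw [← h3, h1.fderiv_eq, fderiv_clm_apply hd1 (hpd hw)]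
    simp [add_comm]
  rw [hder hv, hder hu]
  have hsymm : IsSymmSndFDerivAt ℝ (f ∘ φ.symm) (φ x) := hF'.isSymmSndFDerivAt (by
    rw [minSmoothness_of_isRCLikeNormedField]; exact WithTop.coe_le_coe.2 (le_top : (2 : ℕ∞) ≤ ⊤))
  rw [hsymm.eq, add_sub_add_left_eq_sub, ← map_sub]
  have hlie : mlieBracket (𝓡 r) u v x = chartSymmDifferential r x (φ x)
      (fderiv ℝ (pull v) (φ x) (pull u (φ x)) - fderiv ℝ (pull u) (φ x) (pull v (φ x))) := by
    have hinv := isInvertible_mfderiv_extChartAt (I := 𝓡 r) (mem_extChartAt_source (I := 𝓡 r) x)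
    have h1 := mfderivWithin_extChartAt_symm_comp_mfderiv_extChartAt' (I := 𝓡 r)
      (mem_extChartAt_source (I := 𝓡 r) x)
    rw [ModelWithCorners.range_eq_univ, mfderivWithin_univ] at h1
    have h2 : mlieBracket (𝓡 r) u v x = (mfderiv (𝓡 r) 𝓘(ℝ, EuclideanSpace ℝ (Fin r)) φ x).inverse
        (fderivWithin ℝ (pull v) (φ.symm ⁻¹' univ ∩ range (𝓡 r)) (φ x) (pull u (φ x))
          - fderivWithin ℝ (pull u) (φ.symm ⁻¹' univ ∩ range (𝓡 r)) (φ x) (pull v (φ x))) := by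
      rw [← mlieBracketWithin_univ]
      exact mlieBracketWithin_apply
    rw [preimage_univ, univ_inter, ModelWithCorners.range_eq_univ, fderivWithin_univ,
      fderivWithin_univ] at h2
    rw [h2]
    have h3 := congrArg (fun T => T ((mfderiv (𝓡 r) 𝓘(ℝ, EuclideanSpace ℝ (Fin r)) φ x).inverse
        (fderiv ℝ (pull v) (φ x) (pull u (φ x)) - fderiv ℝ (pull u) (φ x) (pull v (φ x))))) h1
    refine h3.symm.trans ?_
    refine congrArg (chartSymmDifferential r x (φ x)) ?_
    exact hinv.self_apply_inverse _
  have h5 := congrArg (fun T : EuclideanSpace ℝ (Fin r) →L[ℝ] G => T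
      (fderiv ℝ (pull v) (φ x) (pull u (φ x)) - fderiv ℝ (pull u) (φ x) (pull v (φ x))))
    (fderiv_comp_extChartAt_symm hy₀ (hmd hf _ hyO))
  rw [h5, ContinuousLinearMap.comp_apply, ← hlie, hφx]

end Differential

/-! ### The normal projection and the curvature of the normal connection -/

namespace NormalizedVariety

section NormalProjection

open Set Filter Topology VectorField

variable {r l : ℕ}
  {M : Type*} [TopologicalSpace M] [ChartedSpace (EuclideanSpace ℝ (Fin r)) M]
  [IsManifold (𝓡 r) ∞ M]
  {E : Type*} [NormedAddCommGroup E] [NormedSpace ℝ E] [FiniteDimensional ℝ E]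
  (X : NormalizedVariety r l M E)

/-- The projection onto the direction of the first normal, as a continuous linear map. -/
noncomputable def normalProjL (x : M) : E →L[ℝ] E :=
  LinearMap.toContinuousLinearMap (X.normalProj x)

omit [FiniteDimensional ℝ E] in
lemma mem_tangentDirection_iff {x : M} {e : E} :
    e ∈ X.tangentDirection x ↔ ∃ u, differential r X.pos x u = e :=
  Iff.rfl

omit [FiniteDimensional ℝ E] in
lemma isCompl_tangentDirection (x : M) : IsCompl (X.tangentDirection x) (X.normal x) :=
  X.isCompl_tangent_normal x

lemma normalProjL_mem (x : M) (e : E) : X.normalProjL x e ∈ X.normal x :=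
  Submodule.projection_apply_mem _ e

lemma normalProjL_eq_self_iff {x : M} {e : E} : X.normalProjL x e = e ↔ e ∈ X.normal x :=
  ⟨fun h => h ▸ X.normalProjL_mem x e, fun h =>
    Submodule.projection_apply_left (X.isCompl_tangent_normal x).symm ⟨e, h⟩⟩

lemma normalProjL_eq_zero_iff {x : M} {e : E} :
    X.normalProjL x e = 0 ↔ e ∈ X.tangentDirection x :=
  Submodule.projection_apply_eq_zero_iff (X.isCompl_tangent_normal x).symm

lemma normalProjL_normalProjL (x : M) (e : E) :
    X.normalProjL x (X.normalProjL x e) = X.normalProjL x e :=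
  X.normalProjL_eq_self_iff.2 (X.normalProjL_mem x e)

omit [FiniteDimensional ℝ E] in
lemma finrank_normal (x : M) : Module.finrank ℝ (X.normal x) = l := by
  obtain ⟨U, -, hxU, A, -, hA⟩ := X.exists_smooth_frame x
  rw [← (hA x hxU).2, finrank_span_eq_card (hA x hxU).1, Fintype.card_fin]

omit [FiniteDimensional ℝ E] in
lemma injective_differential_pos (x : M) : Function.Injective (differential r X.pos x) :=
  X.injective_mfderiv_pos x

/-- The projections onto the normals depend smoothly on the point: in a chart and a smooth frame of
the normals they are `C ∘ (0 × id) ∘ C⁻¹`, where `C` is the smooth field of isomorphisms that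
the tangent map and the frame form together. -/
lemma contMDiff_normalProjL : ContMDiff (𝓡 r) 𝓘(ℝ, E →L[ℝ] E) ∞ X.normalProjL := by
  intro x₀
  obtain ⟨U, hU, hxU, A, hA, hframe⟩ := X.exists_smooth_frame x₀
  set φ := extChartAt (𝓡 r) x₀ with hφ
  have hp : ContDiffOn ℝ ∞ (X.pos ∘ φ.symm) φ.target := by
    have := contDiffOn_comp_extChartAt_symm le_rfl X.contMDiff_pos.contMDiffOn x₀ (W := univ)
    rwa [preimage_univ, inter_univ] at this
  have hQ : ContMDiffOn (𝓡 r) 𝓘(ℝ, EuclideanSpace ℝ (Fin r) →L[ℝ] E) ∞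
      (fun x => fderiv ℝ (X.pos ∘ φ.symm) (φ x)) φ.source := by
    refine (contMDiffOn_comp_extChartAt
      (hp.fderiv_of_isOpen (m := ∞) (isOpen_extChartAt_target x₀) (by simp)) x₀).mono ?_
    exact fun x hx => ⟨hx, φ.map_source hx⟩
  let L : M → (Fin l → ℝ) →L[ℝ] E := fun x =>
    ∑ a, (ContinuousLinearMap.proj (R := ℝ) (φ := fun _ : Fin l => ℝ) a).smulRight (A a x)
  have hLapp : ∀ x c, L x c = ∑ a, c a • A a x := fun x c => by
    simp [L, sum_apply]
  have hL : ContMDiffOn (𝓡 r) 𝓘(ℝ, (Fin l → ℝ) →L[ℝ] E) ∞ L U := by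
    refine contMDiffOn_finsetSum fun a _ => ?_
    exact (ContinuousLinearMap.smulRightL ℝ (Fin l → ℝ) E
      (ContinuousLinearMap.proj (R := ℝ) (φ := fun _ : Fin l => ℝ) a)).contMDiff.comp_contMDiffOn
      (hA a)
  let C : M → (EuclideanSpace ℝ (Fin r) × (Fin l → ℝ)) →L[ℝ] E := fun x =>
    (fderiv ℝ (X.pos ∘ φ.symm) (φ x)).comp (ContinuousLinearMap.fst ℝ _ _)
      + (L x).comp (ContinuousLinearMap.snd ℝ _ _)
  have hC : ContMDiffAt (𝓡 r) 𝓘(ℝ, (EuclideanSpace ℝ (Fin r) × (Fin l → ℝ)) →L[ℝ] E) ∞ C x₀ := by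
    have h1 := hQ.contMDiffAt (extChartAt_source_mem_nhds x₀)
    have h2 := hL.contMDiffAt (hU.mem_nhds hxU)
    exact (h1.clm_comp contMDiffAt_const).add (h2.clm_comp contMDiffAt_const)
  have hQmem : ∀ x ∈ φ.source, ∀ u,
      fderiv ℝ (X.pos ∘ φ.symm) (φ x) u
        = differential r X.pos x (chartSymmDifferential r x₀ (φ x) u) := by
    intro x hx u
    have hx' : φ.symm (φ x) = x := φ.left_inv hx
    rw [fderiv_comp_extChartAt_symm (φ.map_source hx)
      ((X.contMDiff_pos _).mdifferentiableAt (by simp)), ContinuousLinearMap.comp_apply, hx']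
  have hLmem : ∀ x ∈ U, ∀ c, L x c ∈ X.normal x := fun x hx c => by
    rw [hLapp, ← (hframe x hx).2]
    exact Submodule.sum_mem _ fun a _ => Submodule.smul_mem _ _ (Submodule.subset_span ⟨a, rfl⟩)
  have hCπ : ∀ x ∈ φ.source ∩ U, ∀ p, X.normalProjL x (C x p) = C x (0, p.2) := by
    intro x hx p
    have h1 : X.normalProjL x (fderiv ℝ (X.pos ∘ φ.symm) (φ x) p.1) = 0 :=
      X.normalProjL_eq_zero_iff.2 (X.mem_tangentDirection_iff.2 ⟨_, (hQmem x hx.1 _).symm⟩)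
    have h2 : X.normalProjL x (L x p.2) = L x p.2 :=
      X.normalProjL_eq_self_iff.2 (hLmem x hx.2 _)
    simp [C, h1, h2]
  have hinv : ∀ x ∈ φ.source ∩ U, (C x).IsInvertible := by
    intro x hx
    have hb := bijective_chartSymmDifferential (φ.map_source hx.1)
    have hinj : Function.Injective (C x) := by
      rw [injective_iff_map_eq_zero]
      intro p hp0
      have h1 := hCπ x hx p
      rw [hp0, map_zero] at h1
      have h2 : L x p.2 = 0 := by simpa [C] using h1.symm
      have h3 : fderiv ℝ (X.pos ∘ φ.symm) (φ x) p.1 = 0 := by simpa [C, h2] using hp0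
      rw [hQmem x hx.1] at h3
      have h4 : p.1 = 0 := by
        apply hb.1
        apply X.injective_differential_pos x
        rw [h3, map_zero, map_zero]
      have h5 : p.2 = 0 := by
        rw [hLapp] at h2
        exact funext (Fintype.linearIndependent_iff.1 (hframe x hx.2).1 p.2 h2)
      exact Prod.ext h4 h5
    have hsurj : Function.Surjective (C x) := by
      intro e
      have htop : e ∈ X.tangentDirection x ⊔ X.normal x := by
        rw [(X.isCompl_tangentDirection x).sup_eq_top]; trivial
      obtain ⟨t, ht, n, hn, rfl⟩ := Submodule.mem_sup.1 htop
      obtain ⟨u, rfl⟩ := X.mem_tangentDirection_iff.1 ht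
      obtain ⟨u, rfl⟩ := hb.2 u
      rw [← (hframe x hx.2).2, Submodule.mem_span_range_iff_exists_fun] at hn
      obtain ⟨c, rfl⟩ := hn
      refine ⟨(u, c), ?_⟩
      simp [C, hLapp, hQmem x hx.1]
    exact ⟨ContinuousLinearEquiv.ofBijective (C x)
      (LinearMap.ker_eq_bot.2 hinj) (LinearMap.range_eq_top.2 hsurj), rfl⟩
  have hmem : φ.source ∩ U ∈ 𝓝 x₀ :=
    inter_mem (extChartAt_source_mem_nhds x₀) (hU.mem_nhds hxU)
  have hx₀ : x₀ ∈ φ.source ∩ U := mem_of_mem_nhds hmem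
  have hCinv : ContMDiffAt (𝓡 r) 𝓘(ℝ, E →L[ℝ] (EuclideanSpace ℝ (Fin r) × (Fin l → ℝ))) ∞
      (fun x => (C x).inverse) x₀ :=
    ((hinv x₀ hx₀).contDiffAt_map_inverse.contMDiffAt).comp x₀ hC
  have hfinal := (hC.clm_comp (contMDiffAt_const (c := (ContinuousLinearMap.inr ℝ
    (EuclideanSpace ℝ (Fin r)) (Fin l → ℝ)).comp (ContinuousLinearMap.snd ℝ _ _)))).clm_comp hCinv
  refine hfinal.congr_of_eventuallyEq ?_
  filter_upwards [hmem] with x hx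
  ext e
  obtain ⟨p, rfl⟩ := (hinv x hx).bijective.2 e
  rw [hCπ x hx]
  simp only [ContinuousLinearMap.comp_apply, (hinv x hx).inverse_apply_self]
  rfl

lemma mdifferentiableAt_normalProjL (x : M) :
    MDifferentiableAt (𝓡 r) 𝓘(ℝ, E →L[ℝ] E) X.normalProjL x :=
  (X.contMDiff_normalProjL x).mdifferentiableAt (by simp)

/-- The differential of a field of vectors lying in the first normals. -/
lemma differential_of_eventually_mem_normal {s : M → E} {x : M}
    (hs : MDifferentiableAt (𝓡 r) 𝓘(ℝ, E) s x) (hn : ∀ᶠ y in 𝓝 x, s y ∈ X.normal y)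
    (u : EuclideanSpace ℝ (Fin r)) :
    differential r s x u
      = differential r X.normalProjL x u (s x) + X.normalProjL x (differential r s x u) := by
  rw [← differential_clm_apply (X.mdifferentiableAt_normalProjL x) hs]
  congr 1
  exact differential_congr (hn.mono fun y hy => (X.normalProjL_eq_self_iff.2 hy).symm)

/-- The differential of the projection: `dπ = dπ π + π dπ`. -/
lemma differential_normalProjL_apply (x : M) (u : EuclideanSpace ℝ (Fin r)) (e : E) :
    differential r X.normalProjL x u e = differential r X.normalProjL x u (X.normalProjL x e)
      + X.normalProjL x (differential r X.normalProjL x u e) := by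
  have hd : differential r (fun y => X.normalProjL y e) x u
      = differential r X.normalProjL x u e := by
    rw [differential_clm_apply (X.mdifferentiableAt_normalProjL x) mdifferentiableAt_const,
      differential_const]
    simp
  have h := X.differential_of_eventually_mem_normal (s := fun y => X.normalProjL y e) (x := x)
    ((X.mdifferentiableAt_normalProjL x).clm_apply mdifferentiableAt_const)
    (Eventually.of_forall fun y => X.normalProjL_mem y e) u
  rwa [hd] at h

/-- The differential of the projection maps the normal directions into the tangent directions. -/
lemma normalProjL_differential_apply_of_mem {x : M} (u : EuclideanSpace ℝ (Fin r)) {e : E}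
    (he : e ∈ X.normal x) : X.normalProjL x (differential r X.normalProjL x u e) = 0 := by
  have h := X.differential_normalProjL_apply x u e
  rw [X.normalProjL_eq_self_iff.2 he] at h
  exact left_eq_add.1 h

/-- The differential of the projection maps the tangent directions into the normal directions. -/
lemma normalProjL_differential_apply_of_eq_zero {x : M} (u : EuclideanSpace ℝ (Fin r)) {e : E}
    (he : X.normalProjL x e = 0) :
    X.normalProjL x (differential r X.normalProjL x u e) = differential r X.normalProjL x u e := by
  have h := X.differential_normalProjL_apply x u e
  rw [he, map_zero, zero_add] at h
  exact h.symm

lemma normalCovDeriv_apply (u : Π x : M, TangentSpace (𝓡 r) x) (s : M → E) (x : M) :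
    X.normalCovDeriv u s x = X.normalProjL x (differential r s x (u x)) :=
  rfl

/-- The curvature of the normal connection is the normal part of the commutator of the
differentials of the normal projection: an affine form of the Ricci equation. -/
lemma normalCurvature_eq {W : Set M} (hW : IsOpen W) {u v : Π x : M, TangentSpace (𝓡 r) x}
    (hu : ContMDiffOn (𝓡 r) (𝓡 r).tangent ∞ (fun x => (⟨x, u x⟩ : TangentBundle (𝓡 r) M)) W)
    (hv : ContMDiffOn (𝓡 r) (𝓡 r).tangent ∞ (fun x => (⟨x, v x⟩ : TangentBundle (𝓡 r) M)) W)
    {s : M → E} (hs : X.IsNormalField s W) {x : M} (hx : x ∈ W) :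
    X.normalCurvature u v s x =
      X.normalProjL x (differential r X.normalProjL x (u x)
        (differential r X.normalProjL x (v x) (s x)))
      - X.normalProjL x (differential r X.normalProjL x (v x)
        (differential r X.normalProjL x (u x) (s x))) := by
  have hWx := hW.mem_nhds hx
  have hsd : MDifferentiableAt (𝓡 r) 𝓘(ℝ, E) s x :=
    (hs.1.contMDiffAt hWx).mdifferentiableAt (by simp)
  have hsn : ∀ᶠ y in 𝓝 x, s y ∈ X.normal y := (hW.eventually_mem hx).mono hs.2
  have hcov : ∀ {w z : Π x : M, TangentSpace (𝓡 r) x},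
      ContMDiffOn (𝓡 r) (𝓡 r).tangent ∞ (fun x => (⟨x, w x⟩ : TangentBundle (𝓡 r) M)) W →
      X.normalCovDeriv z (X.normalCovDeriv w s) x =
        X.normalProjL x (differential r X.normalProjL x (z x)
          (differential r X.normalProjL x (w x) (s x)))
        + X.normalProjL x (differential r (fun y => differential r s y (w y)) x (z x)) := by
    intro w z hw
    have h1 : MDifferentiableAt (𝓡 r) 𝓘(ℝ, E) (fun y => differential r s y (w y)) x :=
      ((contMDiffOn_differential_apply hW hs.1 hw).contMDiffAt hWx).mdifferentiableAt (by simp)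
    have h2 : X.normalCovDeriv w s = fun y => X.normalProjL y (differential r s y (w y)) := rfl
    have h3 := X.differential_of_eventually_mem_normal hsd hsn (w x)
    have h4 : X.normalProjL x (differential r X.normalProjL x (z x)
        (X.normalProjL x (differential r s x (w x)))) = 0 :=
      X.normalProjL_differential_apply_of_mem _ (X.normalProjL_mem _ _)
    rw [X.normalCovDeriv_apply, h2]
    refine (congrArg (X.normalProjL x) (differential_clm_apply
      (X.mdifferentiableAt_normalProjL x) h1 (z x))).trans ?_
    rw [map_add, X.normalProjL_normalProjL]
    congr 1
    conv_lhs => rw [h3]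
    rw [map_add, map_add, h4, add_zero]
  rw [normalCurvature, hcov hv, hcov hu, X.normalCovDeriv_apply,
    differential_mlieBracket hW hs.1 hu hv hx, map_sub]
  abel

/-- If the normal connection is flat, the differentials of the normal projection commute on the
first normals. -/
lemma IsFlatNormalConnection.differential_normalProjL_comm {X : NormalizedVariety r l M E}
    (hX : X.IsFlatNormalConnection) (x : M) (u v : EuclideanSpace ℝ (Fin r)) (e : E) :
    differential r X.normalProjL x u (differential r X.normalProjL x v (X.normalProjL x e)) =
      differential r X.normalProjL x v (differential r X.normalProjL x u (X.normalProjL x e)) := by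
  have hext : ∀ w : EuclideanSpace ℝ (Fin r), ∃ (W : Set M) (z : Π x : M, TangentSpace (𝓡 r) x),
      W ∈ 𝓝 x ∧ z x = w ∧ ContMDiffOn (𝓡 r) (𝓡 r).tangent ∞
        (fun x => (⟨x, z x⟩ : TangentBundle (𝓡 r) M)) W := by
    intro w
    obtain ⟨W, hW, h⟩ := FiberBundle.exists_contMDiffOn_extend (I := 𝓡 r) (k := ∞)
      (EuclideanSpace ℝ (Fin r)) (V := TangentSpace (𝓡 r)) (x₀ := x) w
    exact ⟨W, _, hW, FiberBundle.extend_apply_self _ _, h⟩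
  obtain ⟨W₁, u', hW₁, hu0, hu⟩ := hext u
  obtain ⟨W₂, v', hW₂, hv0, hv⟩ := hext v
  have hsub : interior (W₁ ∩ W₂) ⊆ W₁ ∩ W₂ := interior_subset
  have hxW : x ∈ interior (W₁ ∩ W₂) := mem_interior_iff_mem_nhds.2 (inter_mem hW₁ hW₂)
  have hu' := hu.mono fun y hy => (hsub hy).1
  have hv' := hv.mono fun y hy => (hsub hy).2
  have hs : X.IsNormalField (fun y => X.normalProjL y e) (interior (W₁ ∩ W₂)) :=
    ⟨(X.contMDiff_normalProjL.clm_apply contMDiff_const).contMDiffOn,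
      fun y _ => X.normalProjL_mem y e⟩
  have h0 := hX _ isOpen_interior u' v' hu' hv' _ hs x hxW
  rw [X.normalCurvature_eq isOpen_interior hu' hv' hs hxW, hu0, hv0] at h0
  have hmem := X.normalProjL_mem x e
  rwa [X.normalProjL_differential_apply_of_eq_zero _
      (X.normalProjL_differential_apply_of_mem _ hmem),
    X.normalProjL_differential_apply_of_eq_zero _
      (X.normalProjL_differential_apply_of_mem _ hmem), sub_eq_zero] at h0

end NormalProjection

end NormalizedVariety

/-! ### Parallel frames of the normals and families of parallel varieties -/

namespace NormalizedVariety

section ParallelFrames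

open Set Filter Topology

variable {r l : ℕ}
  {M : Type*} [TopologicalSpace M] [ChartedSpace (EuclideanSpace ℝ (Fin r)) M]
  [IsManifold (𝓡 r) ∞ M]
  {E : Type*} [NormedAddCommGroup E] [NormedSpace ℝ E] [FiniteDimensional ℝ E]
  {F : Type*} [NormedAddCommGroup F] [NormedSpace ℝ F]
  {F' : Type*} [NormedAddCommGroup F'] [NormedSpace ℝ F']

/-- A smooth field `B` over `U` of linear maps from a fixed vector space `F` into the normals such
that the fields `x ↦ B x f` are parallel with respect to the normal connection. No injectivity is
required. -/
structure IsParallelFrame (X : NormalizedVariety r l M E) (U : Set M) (B : M → F →L[ℝ] E) :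
    Prop where
  contMDiffOn : ContMDiffOn (𝓡 r) 𝓘(ℝ, F →L[ℝ] E) ∞ B U
  mem_normal : ∀ x ∈ U, ∀ f, B x f ∈ X.normal x
  parallel : ∀ x ∈ U, ∀ u f, X.normalProjL x (differential r B x u f) = 0

variable {X : NormalizedVariety r l M E} {U : Set M}

omit [FiniteDimensional ℝ E] in
lemma differential_apply_const {B : M → F →L[ℝ] E} {x : M}
    (hB : MDifferentiableAt (𝓡 r) 𝓘(ℝ, F →L[ℝ] E) B x) (u : EuclideanSpace ℝ (Fin r)) (f : F) :
    differential r (fun y => B y f) x u = differential r B x u f := by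
  rw [differential_clm_apply hB mdifferentiableAt_const, differential_const]
  simp

namespace IsParallelFrame

lemma mdifferentiableAt {B : M → F →L[ℝ] E} (hB : X.IsParallelFrame U B) (hU : IsOpen U) {x : M}
    (hx : x ∈ U) : MDifferentiableAt (𝓡 r) 𝓘(ℝ, F →L[ℝ] E) B x :=
  (hB.contMDiffOn.contMDiffAt (hU.mem_nhds hx)).mdifferentiableAt (by simp)

lemma mono {B : M → F →L[ℝ] E} (hB : X.IsParallelFrame U B) {W : Set M} (hW : W ⊆ U) :
    X.IsParallelFrame W B :=
  ⟨hB.contMDiffOn.mono hW, fun x hx => hB.mem_normal x (hW hx), fun x hx => hB.parallel x (hW hx)⟩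

lemma comp_const {B : M → F →L[ℝ] E} (hB : X.IsParallelFrame U B) (hU : IsOpen U)
    (T : F' →L[ℝ] F) : X.IsParallelFrame U (fun x => (B x).comp T) := by
  have hs : ContMDiffOn (𝓡 r) 𝓘(ℝ, F' →L[ℝ] E) ∞ (fun x => (B x).comp T) U :=
    hB.contMDiffOn.clm_comp contMDiffOn_const
  refine ⟨hs, fun x hx f => hB.mem_normal x hx _, fun x hx u f => ?_⟩
  rw [← differential_apply_const ((hs.contMDiffAt (hU.mem_nhds hx)).mdifferentiableAt (by simp)),
    show (fun y => ((B y).comp T) f) = fun y => B y (T f) from rfl,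
    differential_apply_const (hB.mdifferentiableAt hU hx)]
  exact hB.parallel x hx u _

lemma sub {B C : M → F →L[ℝ] E} (hB : X.IsParallelFrame U B) (hC : X.IsParallelFrame U C)
    (hU : IsOpen U) : X.IsParallelFrame U (fun x => B x - C x) := by
  refine ⟨hB.contMDiffOn.sub hC.contMDiffOn,
    fun x hx f => Submodule.sub_mem _ (hB.mem_normal x hx f) (hC.mem_normal x hx f),
    fun x hx u f => ?_⟩
  rw [differential_sub (hB.mdifferentiableAt hU hx) (hC.mdifferentiableAt hU hx)]
  simp only [sub_apply, map_sub, hB.parallel x hx u f, hC.parallel x hx u f, sub_zero]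

/-- A parallel frame satisfies the differential equation `dB = dπ B`. -/
lemma differential_eq {B : M → F →L[ℝ] E} (hB : X.IsParallelFrame U B) (hU : IsOpen U) {x : M}
    (hx : x ∈ U) (u : EuclideanSpace ℝ (Fin r)) (f : F) :
    differential r B x u f = differential r X.normalProjL x u (B x f) := by
  have hd := hB.mdifferentiableAt hU hx
  have h := X.differential_of_eventually_mem_normal (s := fun y => B y f)
    (hd.clm_apply mdifferentiableAt_const)
    ((hU.eventually_mem hx).mono fun y hy => hB.mem_normal y hy f) u
  rwa [differential_apply_const hd, hB.parallel x hx, add_zero] at h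

/-- A parallel frame that vanishes at a point vanishes near this point. -/
lemma eventually_eq_zero {B : M → F →L[ℝ] E} (hB : X.IsParallelFrame U B) (hU : IsOpen U) {x : M}
    (hx : x ∈ U) (h0 : B x = 0) : ∀ᶠ y in 𝓝 x, B y = 0 := by
  set φ := extChartAt (𝓡 r) x with hφ
  have hφx : φ.symm (φ x) = x := extChartAt_to_inv x
  set O := φ.target ∩ φ.symm ⁻¹' U with hO
  have hOo : IsOpen O := isOpen_extChartAt_target_inter_preimage hU x
  have hxO : φ x ∈ O := ⟨mem_extChartAt_target x, by rw [mem_preimage, hφx]; exact hx⟩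
  have hP : ContDiffAt ℝ 1 (X.normalProjL ∘ φ.symm) (φ x) :=
    ((contDiffOn_comp_extChartAt_symm le_rfl X.contMDiff_normalProjL.contMDiffOn x).contDiffAt
      (hOo.mem_nhds hxO)).of_le (by simp)
  obtain ⟨N, hN, h⟩ := exists_nhds_forall_eq_zero_of_hasFDerivAt hP (hOo.mem_nhds hxO)
  have hNx : φ ⁻¹' N ∈ 𝓝 x := (continuousAt_extChartAt x).preimage_mem_nhds hN
  filter_upwards [hNx, extChartAt_source_mem_nhds (I := 𝓡 r) x] with y hyN hys
  ext f
  have hz := h (fun z => B (φ.symm z) f) (fun z hz => ?_) (by rw [hφx, h0]; rfl) (φ y) hyN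
  · rwa [show φ.symm (φ y) = y from φ.left_inv hys] at hz
  · have hd := hB.mdifferentiableAt hU hz.2
    have hd' : MDifferentiableAt (𝓡 r) 𝓘(ℝ, E) (fun y => B y f) (φ.symm z) :=
      hd.clm_apply mdifferentiableAt_const
    have h1 := (differentiableAt_comp_extChartAt_symm hz.1 hd').hasFDerivAt
    refine h1.congr_fderiv ?_
    ext u
    rw [fderiv_comp_extChartAt_symm hz.1 hd', ContinuousLinearMap.flip_apply,
      fderiv_comp_extChartAt_symm hz.1 (X.mdifferentiableAt_normalProjL _),
      ContinuousLinearMap.comp_apply, ContinuousLinearMap.comp_apply,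
      differential_apply_const hd, hB.differential_eq hU hz.2]

end IsParallelFrame

/-- If the normal connection is flat, the normal vectors at `x₀` extend to parallel fields on a
neighbourhood of `x₀`. -/
theorem IsFlatNormalConnection.exists_isParallelFrame (hX : X.IsFlatNormalConnection) (x₀ : M) :
    ∃ U : Set M, IsOpen U ∧ x₀ ∈ U ∧ ∃ B : M → E →L[ℝ] E, X.IsParallelFrame U B ∧
      B x₀ = X.normalProjL x₀ ∧ ∀ x ∈ U, ∀ e ∈ X.normal x₀, B x e = 0 → e = 0 := by
  set φ := extChartAt (𝓡 r) x₀ with hφ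
  have hφx : φ.symm (φ x₀) = x₀ := extChartAt_to_inv x₀
  set P := X.normalProjL ∘ φ.symm with hPdef
  have hPx₀ : P (φ x₀) = X.normalProjL x₀ := by rw [hPdef, Function.comp_apply, hφx]
  have hP : ContDiffOn ℝ ∞ P φ.target := by
    have := contDiffOn_comp_extChartAt_symm le_rfl X.contMDiff_normalProjL.contMDiffOn x₀
      (W := univ)
    rwa [preimage_univ, inter_univ] at this
  obtain ⟨B, hBsub, hBo, hxB, S, hS0, hS, hPS, hdS⟩ := exists_parallel_operator_field
    (isOpen_extChartAt_target x₀) hP (fun y _ e => X.normalProjL_normalProjL _ e)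
    (fun y hy u v e => by
      rw [fderiv_comp_extChartAt_symm hy (X.mdifferentiableAt_normalProjL _)]
      exact hX.differential_normalProjL_comm _ _ _ _)
    (mem_extChartAt_target x₀)
  -- The frame stays injective on the normal at `x₀` as long as `S + (1 - π)` is invertible.
  set D := B ∩ (fun y => S y + (1 - P (φ x₀))) ⁻¹' {T | IsUnit T} with hDdef
  have hDo : IsOpen D :=
    (hS.continuousOn.add continuousOn_const).isOpen_inter_preimage hBo Units.isOpen
  have hS0' : S (φ x₀) = P (φ x₀) := hS0
  have hxD : φ x₀ ∈ D := ⟨hxB, by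
    rw [mem_preimage, mem_ofPred_eq, hS0', add_sub_cancel]
    exact isUnit_one⟩
  have hUo : IsOpen (φ.source ∩ φ ⁻¹' D) := isOpen_extChartAt_preimage' x₀ hDo
  have hsm : ContMDiffOn (𝓡 r) 𝓘(ℝ, E →L[ℝ] E) ∞ (S ∘ φ) (φ.source ∩ φ ⁻¹' D) :=
    (contMDiffOn_comp_extChartAt hS x₀).mono fun x hx => ⟨hx.1, hx.2.1⟩
  refine ⟨φ.source ∩ φ ⁻¹' D, hUo, ⟨mem_extChartAt_source x₀, hxD⟩, S ∘ φ, ⟨hsm, ?_, ?_⟩, ?_, ?_⟩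
  · intro x hx e
    have h := hPS (φ x) hx.2.1 e
    rw [hPdef, Function.comp_apply, φ.left_inv hx.1] at h
    exact X.normalProjL_eq_self_iff.1 h
  · intro x hx u e
    have hy : φ x ∈ φ.target := φ.map_source hx.1
    have hx' : φ.symm (φ x) = x := φ.left_inv hx.1
    obtain ⟨w, rfl⟩ := (bijective_chartSymmDifferential hy).2 u
    have h1 := fderiv_comp_extChartAt_symm (f := S ∘ φ) hy (by
      rw [show (extChartAt (𝓡 r) x₀).symm (φ x) = x from hx']
      exact (hsm.contMDiffAt (hUo.mem_nhds hx)).mdifferentiableAt (by simp))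
    have h2 : (S ∘ φ) ∘ φ.symm =ᶠ[𝓝 (φ x)] S := by
      filter_upwards [(isOpen_extChartAt_target x₀).mem_nhds hy] with y hy
      exact congrArg S (φ.right_inv hy)
    rw [h2.fderiv_eq, hx'] at h1
    have h3 := hdS (φ x) hx.2.1 w e
    rw [h1, hPdef, Function.comp_apply, hx'] at h3
    exact h3
  · rw [Function.comp_apply, hS0', hPx₀]
  · intro x hx e he h0
    obtain ⟨T, hT⟩ : IsUnit (S (φ x) + (1 - P (φ x₀))) := hx.2.2
    have h1 : (T : E →L[ℝ] E) e = 0 := by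
      have h0' : S (φ x) e = 0 := h0
      rw [hT, add_apply, h0', hPx₀, sub_apply, X.normalProjL_eq_self_iff.2 he]
      simp
    calc e = ((T⁻¹ : (E →L[ℝ] E)ˣ) * T : E →L[ℝ] E) e := by rw [Units.inv_mul]; rfl
      _ = 0 := by rw [mul_apply_eq_comp, h1, map_zero]

/-- A parallel frame over `U` that is the identity on the normal at `x₀` and injective on it
translates the variety to an `l`-parameter family of parallel varieties. -/
theorem IsParallelFrame.isParallelFamily {B : M → E →L[ℝ] E} (hB : X.IsParallelFrame U B)
    (hU : IsOpen U) {x₀ : M} (hid : ∀ e ∈ X.normal x₀, B x₀ e = e)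
    (hinj : ∀ x ∈ U, ∀ e ∈ X.normal x₀, B x e = 0 → e = 0) :
    X.IsParallelFamily U x₀ (fun η x => X.pos x + B x η) := by
  have hpos : ∀ x, MDifferentiableAt (𝓡 r) 𝓘(ℝ, E) X.pos x := fun x =>
    (X.contMDiff_pos x).mdifferentiableAt (by simp)
  have hsm : ∀ η : E, ContMDiffOn (𝓡 r) 𝓘(ℝ, E) ∞ (fun x => X.pos x + B x η) U := fun η =>
    X.contMDiff_pos.contMDiffOn.add (hB.contMDiffOn.clm_apply contMDiffOn_const)
  have hmem : ∀ η : E, ∀ x ∈ U, X.pos x + B x η ∈ X.firstNormal x := fun η x hx => by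
    rw [firstNormal, AffineSubspace.mem_mk', vsub_eq_sub, add_sub_cancel_left]
    exact hB.mem_normal x hx η
  have hrange : ∀ η : E, ∀ x ∈ U, ∀ u,
      differential r (fun x => X.pos x + B x η) x u ∈ X.tangentDirection x := by
    intro η x hx u
    have hd := hB.mdifferentiableAt hU hx
    rw [differential_add (hpos x) (hd.clm_apply mdifferentiableAt_const), add_apply,
      differential_apply_const hd]
    exact Submodule.add_mem _ (X.mem_tangentDirection_iff.2 ⟨u, rfl⟩)
      (X.normalProjL_eq_zero_iff.1 (hB.parallel x hx u η))
  have hle : ∀ η : E, ∀ x ∈ U,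
      imageDirection r (fun x => X.pos x + B x η) x ≤ X.tangentDirection x := by
    rintro η x hx _ ⟨u, rfl⟩
    exact hrange η x hx u
  have hmk : ∀ (p : E) {S T : Submodule ℝ E}, S ≤ T →
      AffineSubspace.mk' p S ≤ AffineSubspace.mk' p T := fun p S T h q hq => by
    rw [AffineSubspace.mem_mk'] at hq ⊢
    exact h hq
  refine ⟨?_, fun η => ⟨hsm η, hmem η, fun x hx => hmk _ (hle η x hx), fun x hx hfoc => ?_⟩,
    fun η => by rw [hid _ η.2], fun x hx => ⟨fun η _ => hmem η x hx, ?_, ?_⟩⟩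
  · have h1 : ContMDiffOn ((𝓡 r).prod 𝓘(ℝ, X.normal x₀)) (𝓡 r) ∞
        (Prod.fst : M × X.normal x₀ → M) (U ×ˢ univ) := contMDiffOn_fst
    have h2 : ContMDiffOn ((𝓡 r).prod 𝓘(ℝ, X.normal x₀)) 𝓘(ℝ, X.normal x₀) ∞
        (Prod.snd : M × X.normal x₀ → X.normal x₀) (U ×ˢ univ) := contMDiffOn_snd
    have h3 := (X.normal x₀).subtypeL.contMDiff.comp_contMDiffOn h2 (n := ∞)
    exact (X.contMDiff_pos.comp_contMDiffOn h1).add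
      ((hB.contMDiffOn.comp h1 fun p hp => hp.1).clm_apply h3)
  -- Away from the foci the differential is injective, so its image is the whole tangent direction.
  · have hinjd : Function.Injective (differential r (fun x => X.pos x + B x η) x) := by
      rw [injective_iff_map_eq_zero]
      intro w hw
      by_contra hw0
      refine hfoc ⟨U, hU, hx, _, hsm η, hmem η, rfl, w, hw0, ?_⟩
      have hw' : (mfderiv (𝓡 r) 𝓘(ℝ, E) (fun x => X.pos x + B x η) x w : E) = 0 := hw
      rw [hw']
      exact Submodule.zero_mem _
    have hfin : ∀ f : M → E, Function.Injective (differential r f x) →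
        Module.finrank ℝ (imageDirection r f x) = r := fun f hf => by
      have h := LinearMap.finrank_range_of_inj (f := (differential r f x).toLinearMap) hf
      rw [finrank_euclideanSpace_fin] at h
      exact h
    have heq : imageDirection r (fun x => X.pos x + B x η) x = X.tangentDirection x :=
      Submodule.eq_of_le_of_finrank_eq (hle η x hx)
        ((hfin _ hinjd).trans (hfin _ (X.injective_differential_pos x)).symm)
    rw [heq]
    rfl
  · intro η _ ζ _ h
    have h1 : B x η = B x ζ := add_left_cancel h
    have h2 : B x ((η : E) - ζ) = 0 := by rw [map_sub, h1, sub_self]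
    exact Subtype.ext (sub_eq_zero.1 (hinj x hx _ (Submodule.sub_mem _ η.2 ζ.2) h2))
  · intro q hq
    let T : X.normal x₀ →ₗ[ℝ] X.normal x :=
      ((B x).toLinearMap.comp (X.normal x₀).subtype).codRestrict _ fun e => hB.mem_normal x hx e
    have hT : Function.Injective T := by
      rw [injective_iff_map_eq_zero]
      intro e he
      exact Subtype.ext (hinj x hx e e.2 (congrArg Subtype.val he))
    have hTs : Function.Surjective T :=
      (LinearMap.injective_iff_surjective_of_finrank_eq_finrank
        ((X.finrank_normal x₀).trans (X.finrank_normal x).symm)).1 hT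
    have hq' : q - X.pos x ∈ X.normal x := by
      rw [← vsub_eq_sub, ← AffineSubspace.mem_mk']
      exact hq
    obtain ⟨η, hη⟩ := hTs ⟨q - X.pos x, hq'⟩
    refine ⟨η, mem_univ _, ?_⟩
    have hη' : B x η = q - X.pos x := congrArg Subtype.val hη
    simp only [hη', add_sub_cancel]

/-- A flat normal connection admits parallel families locally. -/
theorem IsFlatNormalConnection.admitsParallelFamilyLocally (hX : X.IsFlatNormalConnection) :
    X.AdmitsParallelFamilyLocally := by
  intro x₀
  obtain ⟨U, hU, hx₀, B, hB, hB0, hinj⟩ := hX.exists_isParallelFrame x₀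
  refine ⟨U, hU, hx₀, _, hB.isParallelFamily hU (fun e he => ?_) hinj⟩
  rw [hB0, X.normalProjL_eq_self_iff.2 he]

/-- Through every normal vector at `x` there passes the parallel normal field given by a parallel
variety. The curvature vanishes on parallel fields, and it depends only on the value of the field at
`x`. -/
theorem AdmitsParallelFamilyLocally.isFlatNormalConnection (hX : X.AdmitsParallelFamilyLocally) :
    X.IsFlatNormalConnection := by
  intro W hW u v hu hv s hs x hx
  obtain ⟨U, hU, hxU, Y, hY⟩ := hX x
  have hsx : s x ∈ X.normal x := hs.2 x hx
  obtain ⟨hg, hgn, hgt, -⟩ := hY.isParallelVariety ⟨s x, hsx⟩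
  set g := Y ⟨s x, hsx⟩ with hgdef
  have hpos : ∀ y, MDifferentiableAt (𝓡 r) 𝓘(ℝ, E) X.pos y := fun y =>
    (X.contMDiff_pos y).mdifferentiableAt (by simp)
  have ht : X.IsNormalField (fun y => g y - X.pos y) (W ∩ U) := by
    refine ⟨(hg.sub X.contMDiff_pos.contMDiffOn).mono inter_subset_right, fun y hy => ?_⟩
    change g y - X.pos y ∈ X.normal y
    rw [← vsub_eq_sub, ← AffineSubspace.mem_mk']
    exact hgn y hy.2
  have htx : g x - X.pos x = s x := by rw [hgdef, hY.apply_base]; simp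
  have hpar : ∀ y ∈ W ∩ U, ∀ w : Π x : M, TangentSpace (𝓡 r) x,
      X.normalCovDeriv w (fun y => g y - X.pos y) y = 0 := by
    intro y hy w
    have hgd : MDifferentiableAt (𝓡 r) 𝓘(ℝ, E) g y :=
      (hg.contMDiffAt (hU.mem_nhds hy.2)).mdifferentiableAt (by simp)
    have h1 := AffineSubspace.direction_le (hgt y hy.2)
    rw [Delta, AffineSubspace.direction_mk', AffineSubspace.direction_mk'] at h1
    have h2 : differential r g y (w y) ∈ X.tangentDirection y := h1 ⟨w y, rfl⟩
    have h3 : differential r X.pos y (w y) ∈ X.tangentDirection y := ⟨w y, rfl⟩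
    rw [normalCovDeriv_apply, X.normalProjL_eq_zero_iff, differential_sub hgd (hpos y)]
    exact Submodule.sub_mem _ h2 h3
  have hWU : IsOpen (W ∩ U) := hW.inter hU
  have hpar2 : ∀ w z : Π x : M, TangentSpace (𝓡 r) x,
      X.normalCovDeriv z (X.normalCovDeriv w fun y => g y - X.pos y) x = 0 := by
    intro w z
    have h1 : X.normalCovDeriv w (fun y => g y - X.pos y) =ᶠ[𝓝 x] fun _ => 0 :=
      (hWU.eventually_mem ⟨hx, hxU⟩).mono fun y hy => hpar y hy w
    rw [normalCovDeriv_apply, differential_congr h1, differential_const]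
    exact map_zero _
  have h0 : X.normalCurvature u v (fun y => g y - X.pos y) x = 0 := by
    rw [normalCurvature, hpar2, hpar2, hpar x ⟨hx, hxU⟩]
    simp
  rw [X.normalCurvature_eq hWU (hu.mono inter_subset_left) (hv.mono inter_subset_left) ht ⟨hx, hxU⟩,
    htx] at h0
  rw [X.normalCurvature_eq hW hu hv hs hx]
  exact h0

/-- On a simply connected variety the local parallel frames, which differ by locally constant
changes of basis, can be adjusted to fit together globally. -/
theorem IsFlatNormalConnection.admitsParallelFamilyGlobally [SimplyConnectedSpace M]
    (hX : X.IsFlatNormalConnection) : X.AdmitsParallelFamilyGlobally := by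
  have : LocallyPathConnectedSpace M :=
    ChartedSpace.locallyPathConnectedSpace (EuclideanSpace ℝ (Fin r)) M
  have hfr : ∀ x, Module.finrank ℝ (Fin l → ℝ) = Module.finrank ℝ (X.normal x) := fun x => by
    rw [X.finrank_normal, Module.finrank_fin_fun]
  have hloc : ∀ i : M, ∃ U : Set M, IsOpen U ∧ i ∈ U ∧ ∃ C : M → (Fin l → ℝ) →L[ℝ] E,
      ∃ Φ : Π x, (Fin l → ℝ) ≃ₗ[ℝ] X.normal x, X.IsParallelFrame U C ∧
        ∀ x ∈ U, ∀ c, C x c = Φ x c := by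
    intro i
    obtain ⟨U, hU, hi, B, hB, -, hinj⟩ := hX.exists_isParallelFrame i
    let ψ := LinearEquiv.ofFinrankEq (Fin l → ℝ) (X.normal i) (hfr i)
    let T : (Fin l → ℝ) →L[ℝ] E :=
      LinearMap.toContinuousLinearMap ((X.normal i).subtype.comp ψ.toLinearMap)
    have hC := hB.comp_const hU T
    have hex : ∀ x, ∃ Φ : (Fin l → ℝ) ≃ₗ[ℝ] X.normal x, x ∈ U → ∀ c, (B x).comp T c = Φ c := by
      intro x
      by_cases hx : x ∈ U
      · let Ψ : (Fin l → ℝ) →ₗ[ℝ] X.normal x :=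
          ((B x).comp T).toLinearMap.codRestrict _ fun c => hC.mem_normal x hx c
        have hΨ : Function.Injective Ψ := by
          rw [injective_iff_map_eq_zero]
          intro c hc
          have h1 := hinj x hx (ψ c) (ψ c).2 (congrArg Subtype.val hc)
          exact ψ.map_eq_zero_iff.1 (Subtype.ext h1)
        exact ⟨LinearEquiv.ofInjectiveOfFinrankEq Ψ hΨ (hfr x), fun _ c => rfl⟩
      · exact ⟨LinearEquiv.ofFinrankEq _ _ (hfr x), fun h => absurd h hx⟩
    choose Φ hΦ using hex
    exact ⟨U, hU, hi, _, Φ, hC, hΦ⟩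
  choose U hU hmem C Φ hC hΦ using hloc
  have hcoc : ∀ i j, ∀ x ∈ U i ∩ U j, ∀ᶠ y in 𝓝 x,
      (Φ i y).trans (Φ j y).symm = (Φ i x).trans (Φ j x).symm := by
    intro i j x hx
    have hij : IsOpen (U i ∩ U j) := (hU i).inter (hU j)
    let T : (Fin l → ℝ) →L[ℝ] (Fin l → ℝ) :=
      LinearMap.toContinuousLinearMap ((Φ i x).trans (Φ j x).symm).toLinearMap
    have hD := ((hC i).mono inter_subset_left).sub
      (((hC j).mono inter_subset_right).comp_const hij T) hij
    have h0 := hD.eventually_eq_zero hij hx (by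
      ext1 c
      simp [hΦ i x hx.1, hΦ j x hx.2, T])
    filter_upwards [h0, hij.mem_nhds hx] with y hy hyU
    ext1 c
    have h1 := congrArg (fun S : (Fin l → ℝ) →L[ℝ] E => S c) hy
    simp only [sub_apply, ContinuousLinearMap.comp_apply, zero_apply, hΦ i y hyU.1,
      hΦ j y hyU.2, sub_eq_zero] at h1
    rw [LinearEquiv.trans_apply, LinearEquiv.symm_apply_eq]
    exact Subtype.ext h1
  obtain ⟨f, hf, hcob⟩ := exists_coboundary_of_locally_constant_cocycle (U := U)
    (c := fun i j x => (Φ i x).trans (Φ j x).symm) hU hmem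
    (fun i x _ => by ext1 c; simp)
    (fun i j k x _ => by ext1 c; simp) hcoc
  -- By the coboundary relation the frames `Φ i x ∘ f i x` do not depend on `i`.
  let Ψ : Π x, (Fin l → ℝ) ≃ₗ[ℝ] X.normal x := fun x => (f x x).trans (Φ x x)
  have hΨ : ∀ i, ∀ x ∈ U i, ∀ c, Ψ x c = Φ i x (f i x c) := by
    intro i x hx c
    have h1 := hcob i x x ⟨hx, hmem x⟩
    simp only [Ψ, LinearEquiv.trans_apply]
    rw [h1, LinearEquiv.mul_apply, LinearEquiv.trans_apply, LinearEquiv.apply_symm_apply]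
  intro x₀
  let T : E →L[ℝ] (Fin l → ℝ) := LinearMap.toContinuousLinearMap
    ((Ψ x₀).symm.toLinearMap.comp ((X.normalProjL x₀).toLinearMap.codRestrict (X.normal x₀)
      fun e => X.normalProjL_mem x₀ e))
  have hT : ∀ e (he : e ∈ X.normal x₀), T e = (Ψ x₀).symm ⟨e, he⟩ := fun e he =>
    congrArg (Ψ x₀).symm (Subtype.ext (X.normalProjL_eq_self_iff.2 he))
  let B : M → E →L[ℝ] E := fun x =>
    (LinearMap.toContinuousLinearMap ((X.normal x).subtype.comp (Ψ x).toLinearMap)).comp T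
  have hBapp : ∀ x e, B x e = Ψ x (T e) := fun x e => rfl
  -- Near a point the global frame arises from the local frame by a constant change of basis.
  have hBloc : ∀ x, ∃ S : E →L[ℝ] (Fin l → ℝ), B =ᶠ[𝓝 x] fun y => (C x y).comp S := by
    intro x
    refine ⟨(LinearMap.toContinuousLinearMap (f x x).toLinearMap).comp T, ?_⟩
    filter_upwards [(hU x).mem_nhds (hmem x), hf x x (hmem x)] with y hy hfy
    ext e
    rw [hBapp, hΨ x y hy, hfy, ContinuousLinearMap.comp_apply, hΦ x y hy]
    rfl
  have hB : X.IsParallelFrame univ B := by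
    refine ⟨fun x _ => ?_, fun x _ e => (Ψ x (T e)).2, fun x _ u e => ?_⟩
    · obtain ⟨S, hS⟩ := hBloc x
      exact ((((hC x).comp_const (hU x) S).contMDiffOn.contMDiffAt
        ((hU x).mem_nhds (hmem x))).congr_of_eventuallyEq hS).contMDiffWithinAt
    · obtain ⟨S, hS⟩ := hBloc x
      rw [differential_congr hS]
      exact ((hC x).comp_const (hU x) S).parallel x (hmem x) u e
  refine ⟨_, hB.isParallelFamily isOpen_univ (fun e he => ?_) fun x _ e he h0 => ?_⟩
  · rw [hBapp, hT e he, LinearEquiv.apply_symm_apply]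
  · rw [hBapp, hT e he] at h0
    have h1 := (Ψ x).map_eq_zero_iff.1 (Subtype.ext h0)
    exact congrArg Subtype.val ((Ψ x₀).symm.map_eq_zero_iff.1 h1)

end ParallelFrames

end NormalizedVariety

theorem theorem7 {r l : ℕ}
    {M : Type*} [TopologicalSpace M] [ChartedSpace (EuclideanSpace ℝ (Fin r)) M]
    [IsManifold (𝓡 r) ∞ M]
    {E : Type*} [NormedAddCommGroup E] [NormedSpace ℝ E] [FiniteDimensional ℝ E]
    (X : NormalizedVariety r l M E) :
    (X.IsFlatNormalConnection ↔ X.AdmitsParallelFamilyLocally) ∧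
    (SimplyConnectedSpace M →
      (X.IsFlatNormalConnection ↔ X.AdmitsParallelFamilyGlobally)) := by
  refine ⟨⟨fun h => h.admitsParallelFamilyLocally, fun h => h.isFlatNormalConnection⟩,
    fun _ => ⟨fun h => h.admitsParallelFamilyGlobally, fun h => ?_⟩⟩
  refine NormalizedVariety.AdmitsParallelFamilyLocally.isFlatNormalConnection fun x₀ => ?_
  exact ⟨Set.univ, isOpen_univ, Set.mem_univ x₀, h x₀⟩
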